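/- Let $k=\mathbb F_q$ be a finite field and put $v=\sqrt q>1$. Let $\mathscr A$ be a $k$-linear abelian category in which all $\mathrm{Hom}(X,Y)$ and $\mathrm{Ext}^1(X,Y)$ are finite dimensional over $k$, which is hereditary ($\mathrm{Ext}^n=0$ for $n\ge 2$), and in which every object has a composition series of finite length. Let $\mathcal P$ be the set of isomorphism classes of objects, $M_\alpha$ a representative of $\alpha\in\mathcal P$, and $\mathcal I\subset\mathcal P$ the set of classes of simple objects $S_i$. The dimension vector $\underline{\dim}M\in\mathbb N\mathcal I$ of an object $M$ records the multiplicities of its composition factors. Put $\langle X,Y\rangle=\dim_k\mathrm{Hom}(X,Y)-\dim_k\mathrm{Ext}^1(X,Y)$ for objects $X,Y$ and $\langle\alpha,\beta\rangle=\langle M_\alpha,M_\beta\rangle$. The symmetric Euler form is the biadditive form $(-,-)$ on $\mathbb Z\mathcal I$ with $(i,j)=\langle S_i,S_j\rangle+\langle S_j,S_i\rangle$ for $i,j\in\mathcal I$. Let $\mathfrak h$ be the complex vector space with basis $\{u_\alpha:\alpha\in\mathcal P\}$ and the bilinear product $$u_\alpha u_\beta=v^{\langle\alpha,\beta\rangle}\sum_{\gamma\in\mathcal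 P}g^\gamma_{\alpha\beta}u_\gamma,$$ where $g^{\gamma}_{\alpha\beta}$ is the number of subobjects $X$ of $M_\gamma$ with $X\cong M_\beta$ and $M_\gamma/X\cong M_\alpha$ (the positive part of the Ringel-Hall algebra). It is graded by $\mathbb N\mathcal I$, where $u_\alpha$ has degree $\underline{\dim}M_\alpha$, and it carries the bilinear form $\psi$ with $\psi(u_\alpha,u_\beta)=\delta_{\alpha\beta}/|\mathrm{Aut}(M_\alpha)|$. For $\theta\in\mathbb N\mathcal I$ let $\Xi_\theta=\mathfrak h_\theta$ if $\theta=0$ or $\theta\in\mathcal I$, and otherwise let $\Xi_\theta=\sum\mathfrak h_\mu\mathfrak h_\nu$, the sum over all $\mu,\nu\in\mathbb N\mathcal I$ with $\mu+\nu=\theta$ and $\mu,\nu\ne\theta$. Put $L_\theta=\{x\in\mathfrak h_\theta:\psi(x,\Xi_\theta)=0\}$. Let $\mathcal J=\{(\theta,p):\theta\in\mathbb N\mathcal I,\ 1\le p\le\dim_{\mathbb C}L_\theta\}$, let $\mathcal I'=\mathcal I\sqcup\mathcal J$, let $\varpi:\mathbb Z\mathcal I'\to\mathbb Z\mathcal I$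 be the linear map with $\varpi(i)=i$ for $i\in\mathcal I$ and $\varpi(\theta,p)=\theta$ for $(\theta,p)\in\mathcal J$, and put $(x,y)'=(\varpi(x),\varpi(y))$ for $x,y\in\mathbb Z\mathcal I'$. Then $(\underline{\dim}M,\underline{\dim}N)=\langle M,N\rangle+\langle N,M\rangle$ for all objects $M,N$, each $L_\theta$ is finite dimensional, and for all $i,j\in\mathcal I'$: (i) if $i\ne j$, then $(i,j)'\le 0$; (ii) if $j\in\mathcal J$, then $(j,j)'\le 0$; (iii) if $(i,i)'>0$, then $\dfrac{2(i,j)'}{(i,i)'}\in\mathbb Z$. In particular $(-,-)':\mathbb Z\mathcal I'\times\mathbb Z\mathcal I'\to\mathbb Z$ is a generalized Kac-Moody bilinear form, that is, a symmetric bilinear form satisfying (i) and (iii). -/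

import Mathlib

open CategoryTheory CategoryTheory.Limits CategoryTheory.Abelian

universe w v u

/-- The set `P` of isomorphism classes of objects of `C`. -/
abbrev IsoClass (C : Type u) [Category.{v} C] : Type u := Quotient (isIsomorphicSetoid C)

/-- A representative `M_α` of the isomorphism class `α`. -/
noncomputable def IsoClass.rep {C : Type u} [Category.{v} C] (α : IsoClass C) : C :=
  Quotient.out α

/-- The set `I` of isomorphism classes of simple objects of `C`. -/
abbrev SimpleClass (C : Type u) [Category.{v} C] [Abelian C] : Type u :=
  {α : IsoClass C // Simple α.rep}

/-- `HasDimVec X d`: the object `X` has a composition series of finite length in which, for every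
class `i` of simple objects, exactly `d i` of the factors lie in the class `i`.  That is,
`d ∈ ℕI` is the dimension vector of `X`. -/
inductive HasDimVec {C : Type u} [Category.{v} C] [Abelian C] :
    C → (SimpleClass C →₀ ℕ) → Prop
  | zero {X : C} (hX : IsZero X) : HasDimVec X 0
  | extend {X Y : C} (f : Y ⟶ X) (hf : Mono f) (i : SimpleClass C)
      (hi : Nonempty (cokernel f ≅ i.1.rep)) (d : SimpleClass C →₀ ℕ) (hY : HasDimVec Y d) :
      HasDimVec X (d + Finsupp.single i 1)

/-- A `k`-linear abelian category which is Hom-finite and Ext-finite, hereditary, and a length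
category. -/
class IsHereditaryFinitaryLength (k : Type*) [Field k] (C : Type u) [Category.{v} C] [Abelian C]
    [Linear k C] [HasExt.{w} C] : Prop where
  finite_hom : ∀ X Y : C, Module.Finite k (X ⟶ Y)
  finite_ext : ∀ X Y : C, Module.Finite k (Ext.{w} X Y 1)
  ext_eq_zero : ∀ (X Y : C) (n : ℕ), 2 ≤ n → Subsingleton (Ext.{w} X Y n)
  exists_dimVec : ∀ X : C, ∃ d : SimpleClass C →₀ ℕ, HasDimVec X d

section EulerForm

variable (k : Type*) [Field k] (C : Type u) [Category.{v} C] [Abelian C] [Linear k C]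
  [HasExt.{w} C]

/-- The Euler form of two objects, `dim Hom(X, Y) - dim Ext¹(X, Y)`. -/
noncomputable def eulerChar {C : Type u} [Category.{v} C] [Abelian C] [Linear k C]
    [HasExt.{w} C] (X Y : C) : ℤ :=
  (Module.finrank k (X ⟶ Y) : ℤ) - (Module.finrank k (Ext.{w} X Y 1) : ℤ)

/-- The Euler form on the Grothendieck group `ℤI`, the free abelian group on the classes of
simple objects. -/
noncomputable def eulerForm :
    (SimpleClass C →₀ ℤ) →ₗ[ℤ] (SimpleClass C →₀ ℤ) →ₗ[ℤ] ℤ :=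
  Finsupp.linearCombination ℤ fun i =>
    Finsupp.linearCombination ℤ fun j => eulerChar.{w} k i.1.rep j.1.rep

/-- The symmetric Euler form `(x, y) = ⟨x, y⟩ + ⟨y, x⟩` on `ℤI`. -/
noncomputable def symEulerForm :
    (SimpleClass C →₀ ℤ) →ₗ[ℤ] (SimpleClass C →₀ ℤ) →ₗ[ℤ] ℤ :=
  eulerForm.{w} k C + (eulerForm.{w} k C).flip

end EulerForm

section HallNumbers

variable {C : Type u} [Category.{v} C] [Abelian C]

/-- The Ringel-Hall number `g^γ_{αβ}`: the number of subobjects `X` of `M_γ` with `X ≅ M_β` and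
`M_γ / X ≅ M_α`. -/
noncomputable def hallNumber (α β γ : IsoClass C) : ℕ :=
  Nat.card {X : Subobject γ.rep //
    Nonempty ((X : C) ≅ β.rep) ∧ Nonempty (cokernel X.arrow ≅ α.rep)}

/-- The order `a_α` of the automorphism group of `M_α`. -/
noncomputable def autCard {C : Type u} [Category.{v} C] (α : IsoClass C) : ℕ := Nat.card (Aut α.rep)

/-- Two extensions of the same objects with the same class have isomorphic middle terms. -/
theorem nonempty_iso_of_extClass_eq [HasExt.{w} C] {A B E E' : C} {f : B ⟶ E} {g : E ⟶ A}
    {f' : B ⟶ E'} {g' : E' ⟶ A} {z : f ≫ g = 0} {z' : f' ≫ g' = 0}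
    (h : (ShortComplex.mk f g z).ShortExact) (h' : (ShortComplex.mk f' g' z').ShortExact)
    (e : h.extClass = h'.extClass) : Nonempty (E ≅ E') := by
  have hc' : h'.extClass.comp (Ext.mk₀ f') (add_zero 1) = 0 := h'.extClass_comp
  obtain ⟨x, hx⟩ := Ext.contravariant_sequence_exact₁ h E' (Ext.mk₀ f') (n₁ := 1) rfl
    (by rw [e]; exact hc')
  obtain ⟨φ, rfl⟩ := (Ext.mk₀_bijective _ _).2 x
  have hφ : f ≫ φ = f' := by
    rw [Ext.mk₀_comp_mk₀] at hx
    exact (Ext.mk₀_bijective _ _).1 hx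
  have hepi : Epi g := h.epi_g
  obtain ⟨p, hp⟩ : ∃ p : A ⟶ A, g ≫ p = φ ≫ g' :=
    ⟨h.exact.desc (φ ≫ g') (by
      change f ≫ φ ≫ g' = 0
      rw [← Category.assoc, hφ, z']), h.exact.g_desc _ _⟩
  let t : ShortComplex.mk f g z ⟶ ShortComplex.mk f' g' z' :=
    { τ₁ := 𝟙 B, τ₂ := φ, τ₃ := p
      comm₁₂ := by simp [hφ]
      comm₂₃ := hp.symm }
  have hnat : h.extClass.comp (Ext.mk₀ (𝟙 B)) (add_zero 1)
      = (Ext.mk₀ p).comp h'.extClass (zero_add 1) := ShortComplex.ShortExact.extClass_naturality h h' t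
  have hker : (Ext.mk₀ (p - 𝟙 A)).comp h'.extClass (zero_add 1) = 0 := by
    have h1 : Ext.mk₀ p = Ext.mk₀ (p - 𝟙 A) + Ext.mk₀ (𝟙 A) := by
      rw [← Ext.mk₀_add, sub_add_cancel]
    rw [h1, Ext.add_comp, Ext.comp_mk₀_id, Ext.mk₀_id_comp, e] at hnat
    exact right_eq_add.1 hnat
  obtain ⟨y, hy⟩ := Ext.covariant_sequence_exact₃ A h' (Ext.mk₀ (p - 𝟙 A)) (n₁ := 1) rfl hker
  obtain ⟨s, rfl⟩ := (Ext.mk₀_bijective _ _).2 y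
  have hs : s ≫ g' = p - 𝟙 A := by
    rw [Ext.mk₀_comp_mk₀] at hy
    exact (Ext.mk₀_bijective _ _).1 hy
  let t' : ShortComplex.mk f g z ⟶ ShortComplex.mk f' g' z' :=
    { τ₁ := 𝟙 B, τ₂ := φ - g ≫ s, τ₃ := 𝟙 A
      comm₁₂ := by simp [hφ, reassoc_of% z]
      comm₂₃ := by simp [Preadditive.sub_comp, ← hp, hs] }
  have : IsIso t'.τ₁ := inferInstanceAs (IsIso (𝟙 B))
  have : IsIso t'.τ₃ := inferInstanceAs (IsIso (𝟙 A))
  have := ShortComplex.isIso₂_of_shortExact_of_isIso₁₃ t' h h'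
  exact ⟨asIso t'.τ₂⟩

/-- Only finitely many objects are extensions of `M_α` by `M_β`. -/
theorem finite_hallNumber_ne_zero [HasExt.{w} C] (α β : IsoClass C)
    [Finite (Ext.{w} α.rep β.rep 1)] : {γ : IsoClass C | hallNumber α β γ ≠ 0}.Finite := by
  have key : ∀ γ : {γ : IsoClass C | hallNumber α β γ ≠ 0},
      ∃ (f : β.rep ⟶ γ.1.rep) (g : γ.1.rep ⟶ α.rep) (z : f ≫ g = 0),
        (ShortComplex.mk f g z).ShortExact := by
    rintro ⟨γ, hγ⟩
    have hne : Nonempty {X : Subobject γ.rep //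
        Nonempty ((X : C) ≅ β.rep) ∧ Nonempty (cokernel X.arrow ≅ α.rep)} := by
      by_contra hcon
      rw [not_nonempty_iff] at hcon
      exact hγ Nat.card_of_isEmpty
    obtain ⟨X, ⟨a⟩, ⟨b⟩⟩ := hne
    have hz : X.arrow ≫ cokernel.π X.arrow = 0 := cokernel.condition _
    have h0 : (ShortComplex.mk X.arrow (cokernel.π X.arrow) hz).ShortExact :=
      { exact := ShortComplex.exact_cokernel _ }
    refine ⟨a.inv ≫ X.arrow, cokernel.π X.arrow ≫ b.hom, by simp, ?_⟩
    exact ShortComplex.shortExact_of_iso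
      (ShortComplex.isoMk (S₁ := ShortComplex.mk X.arrow (cokernel.π X.arrow) hz)
        (S₂ := ShortComplex.mk (a.inv ≫ X.arrow) (cokernel.π X.arrow ≫ b.hom)
        (by simp)) a (Iso.refl _) b (by simp) (by simp)) h0
  choose f g z h using key
  let F : {γ : IsoClass C | hallNumber α β γ ≠ 0} → Ext.{w} α.rep β.rep 1 :=
    fun γ => (h γ).extClass
  have inj : Function.Injective F := by
    intro γ γ' hc
    obtain ⟨i⟩ := nonempty_iso_of_extClass_eq (h γ) (h γ') hc
    apply Subtype.ext
    rw [← Quotient.out_eq γ.1, ← Quotient.out_eq γ'.1]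
    exact Quotient.sound ⟨i⟩
  exact Set.finite_coe_iff.1 (Finite.of_injective _ inj)

end HallNumbers

section HallAlgebra

variable (k : Type*) [Field k] [Finite k] (C : Type u) [Category.{v} C] [Abelian C] [Linear k C]
  [HasExt.{w} C] [IsHereditaryFinitaryLength.{w} k C]

/-- The underlying space of the (positive half of the) Ringel-Hall algebra: the complex vector
space with basis `u_α`, `α ∈ P`. -/
abbrev HallSpace (C : Type u) [Category.{v} C] : Type u := IsoClass C →₀ ℂ

/-- `v = √q` where `q` is the number of elements of `k`. -/
noncomputable def hallV (k : Type*) : ℂ := ((Real.sqrt (Nat.card k) : ℝ) : ℂ)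

/-- The product of basis elements `u_α u_β = v^⟨α, β⟩ ∑_γ g^γ_{αβ} u_γ`. -/
noncomputable def hallBasisMul {C : Type u} [Category.{v} C] [Abelian C] [Linear k C]
    [HasExt.{w} C] [IsHereditaryFinitaryLength.{w} k C] (α β : IsoClass C) : HallSpace C :=
  Finsupp.ofSupportFinite
    (fun γ => hallV k ^ (eulerChar.{w} k α.rep β.rep) * (hallNumber α β γ : ℂ)) <| by
      have := IsHereditaryFinitaryLength.finite_ext (k := k) α.rep β.rep
      have : Finite (Ext.{w} α.rep β.rep 1) := Module.finite_of_finite k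
      refine (finite_hallNumber_ne_zero.{w} α β).subset fun γ hγ h => hγ ?_
      simp [h]

/-- The multiplication of the Ringel-Hall algebra. -/
noncomputable def hallMul : HallSpace C →ₗ[ℂ] HallSpace C →ₗ[ℂ] HallSpace C :=
  Finsupp.linearCombination ℂ fun α => Finsupp.linearCombination ℂ fun β => hallBasisMul.{w} k α β

/-- The bilinear form `ψ(u_α, u_β) = δ_{αβ} / a_α`. -/
noncomputable def hallForm (C : Type u) [Category.{v} C] :
    HallSpace C →ₗ[ℂ] HallSpace C →ₗ[ℂ] ℂ :=
  Finsupp.linearCombination ℂ fun α => (1 / (autCard α : ℂ)) • Finsupp.lapply α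

/-- The homogeneous component of degree `θ`, with basis the `u_α` with `dim M_α = θ`. -/
noncomputable def hallDegree {C : Type u} [Category.{v} C] [Abelian C]
    (θ : SimpleClass C →₀ ℕ) : Submodule ℂ (HallSpace C) :=
  Finsupp.supported ℂ ℂ {α | HasDimVec α.rep θ}

open Classical in
/-- The subspace `Ξ_θ`: the whole component if `θ = 0` or `θ ∈ I`, and the span of all products of
homogeneous elements of degrees `μ, ν ≠ θ` with `μ + ν = θ` otherwise. -/
noncomputable def hallXi {C : Type u} [Category.{v} C] [Abelian C] [Linear k C]
    [HasExt.{w} C] [IsHereditaryFinitaryLength.{w} k C]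
    (θ : SimpleClass C →₀ ℕ) : Submodule ℂ (HallSpace C) :=
  if θ = 0 ∨ ∃ i, θ = Finsupp.single i 1 then hallDegree θ
  else Submodule.span ℂ {z | ∃ (μ ν : SimpleClass C →₀ ℕ) (x y : HallSpace C),
    μ + ν = θ ∧ μ ≠ θ ∧ ν ≠ θ ∧ x ∈ hallDegree μ ∧ y ∈ hallDegree ν ∧ hallMul.{w} k C x y = z}

/-- The subspace `L_θ` of the elements of degree `θ` that are orthogonal to `Ξ_θ`. -/
noncomputable def hallL {C : Type u} [Category.{v} C] [Abelian C] [Linear k C]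
    [HasExt.{w} C] [IsHereditaryFinitaryLength.{w} k C]
    (θ : SimpleClass C →₀ ℕ) : Submodule ℂ (HallSpace C) where
  carrier := {x | x ∈ hallDegree θ ∧ ∀ y ∈ hallXi.{w} k θ, hallForm C x y = 0}
  zero_mem' := ⟨zero_mem _, fun y _ => by simp⟩
  add_mem' := fun ha hb => ⟨add_mem ha.1 hb.1, fun y hy => by simp [ha.2 y hy, hb.2 y hy]⟩
  smul_mem' := fun c _ hx => ⟨Submodule.smul_mem _ c hx.1, fun y hy => by simp [hx.2 y hy]⟩

/-- The set `J` of pairs `(θ, p)` with `θ ∈ ℕI` and `p` one of `dim L_θ` labels. -/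
abbrev NewIndex : Type u :=
  Σ θ : SimpleClass C →₀ ℕ, Fin (Module.finrank ℂ (hallL.{w} k θ))

/-- The enlarged index set `I' = I ∪ J` (a disjoint union). -/
abbrev EnlargedIndex : Type u := SimpleClass C ⊕ NewIndex.{w} k C

/-- The inclusion of `ℕI` in `ℤI`. -/
noncomputable def toIntVec {I : Type*} (d : I →₀ ℕ) : I →₀ ℤ :=
  d.mapRange (fun n : ℕ => (n : ℤ)) Nat.cast_zero

/-- The linear map `ϖ : ℤI' → ℤI` with `ϖ(i) = i` for `i ∈ I` and `ϖ(θ, p) = θ`. -/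
noncomputable def varpi :
    (EnlargedIndex.{w} k C →₀ ℤ) →ₗ[ℤ] (SimpleClass C →₀ ℤ) :=
  Finsupp.linearCombination ℤ
    (Sum.elim (fun i => Finsupp.single i 1) fun j : NewIndex.{w} k C => toIntVec j.1)

/-- The form `(x, y)' = (ϖ x, ϖ y)` on `ℤI'`. -/
noncomputable def enlargedForm :
    (EnlargedIndex.{w} k C →₀ ℤ) →ₗ[ℤ] (EnlargedIndex.{w} k C →₀ ℤ) →ₗ[ℤ] ℤ :=
  (symEulerForm.{w} k C).compl₁₂ (varpi.{w} k C) (varpi.{w} k C)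

end HallAlgebra

/-- An integer valued bilinear form on the free abelian group with basis `ι` is a generalized
Kac-Moody bilinear form if it is symmetric, is nonpositive off the diagonal, and
`2(i, j) / (i, i)` is an integer whenever `(i, i) > 0`. -/
structure IsGeneralizedKacMoodyForm {ι : Type*} (B : (ι →₀ ℤ) →ₗ[ℤ] (ι →₀ ℤ) →ₗ[ℤ] ℤ) : Prop where
  symm : ∀ x y, B x y = B y x
  nonpos : ∀ i j : ι, i ≠ j → B (Finsupp.single i 1) (Finsupp.single j 1) ≤ 0
  integral : ∀ i j : ι, 0 < B (Finsupp.single i 1) (Finsupp.single i 1) →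
    ∃ m : ℤ, (2 * B (Finsupp.single i 1) (Finsupp.single j 1) : ℚ) /
      (B (Finsupp.single i 1) (Finsupp.single i 1) : ℚ) = (m : ℚ)

/-!
# The form attached to a Ringel-Hall algebra is a generalized Kac-Moody form

All the claims reduce to one inequality: if `L_θ` is nonzero, then `(S, θ) ≤ 0` for every simple
object `S` (`symEulerForm_single_nonpos`). Indeed `θ` is a nonnegative combination of simple
classes, so that the remaining signs follow from this one and from `Hom(S, S') = 0` for
nonisomorphic simple objects. For the integrality, `Ext¹(S, S')` is a vector space over the division
ring `End S` on either side. Hence `(S, S')` is a multiple of `dim End S`, and `(S, S) > 0` forces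
`Ext¹(S, S) = 0` and `(S, S) = 2 dim End S`.

The inequality is the Cauchy-Schwarz inequality for `u_S x` and `x u_S`, where `x` is a nonzero
element of `L_θ`, seen as a function on isomorphism classes. By Riedtmann's formula
(`sum_extension_eq`) the number of short exact sequences `0 ⟶ B ⟶ M ⟶ A ⟶ 0`, weighted by `1 / |Aut
M|`, is the number of corresponding classes in `Ext¹(A, B)`, divided by `|Hom(A, B)|`. Therefore the
orthogonality of `x` to all products says that, for all nonzero `A` and `B`, the values of `x` at
the middle terms of the extensions of `A` by `B` add up to zero (`sum_midClass_eq_zero`). This is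
used as follows.

* The squared norm of `u_S x` is a sum over objects `M` with two morphisms `M ⟶ S`. If these are not
  proportional, they form an epimorphism `M ⟶ S ⊞ S` with a kernel `K`; as
  `Ext¹(S ⊞ S, K) = Ext¹(S, K) × Ext¹(S, K)`, the sum of these terms is a product of vanishing sums.
  The proportional pairs contribute `q ^ (-⟨S, θ⟩)` times the squared norm of `x`, up to a constant
  (`sum_sq_kerWeight`). The squared norm of `x u_S` is treated dually (`sum_sq_cokerWeight`).
* The inner product of `u_S x` and `x u_S` is a sum over objects `M` with morphisms `M ⟶ S` and
  `S ⟶ M`. If the composite vanishes, `M` is an extension of `S` by an object `X` that contains the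
  image of `S`, and `M / S` is an extension of `S` by `X / S`. As `Ext²` vanishes, the map
  `Ext¹(S, X) ⟶ Ext¹(S, X / S)` is surjective, and again the sum vanishes. The other terms split and
  contribute the squared norm of `x`, up to the same constant (`sum_kerWeight_mul_cokerWeight`).

Hence `q ^ (-⟨S, θ⟩ - ⟨θ, S⟩) ≥ 1` (`one_le_mul_of_primitive`).

Besides this, the proof needs that every class in `Ext¹` comes from an extension
(`exists_shortExact_extClass_eq`), the Jordan-Hölder theorem (`HasDimVec.unique`) and the additivity
of the Euler form (`eulerForm_eq_eulerChar`).
-/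

/-! ### Every class in `Ext¹` is the class of an extension -/

section Realization

open Pretriangulated DerivedCategory

variable {C : Type u} [Category.{v} C] [Abelian C]

/-- A distinguished triangle between three objects of `C`, all placed in degree `0`, is a short
exact sequence, because there are no morphisms of degree `-1` between objects of `C`. -/
theorem shortExact_of_singleFunctor_distTriang [HasDerivedCategory.{w} C] {A B Y : C}
    (f : B ⟶ Y) (g : Y ⟶ A)
    (δ : (singleFunctor C 0).obj A ⟶ ((singleFunctor C 0).obj B)⟦(1 : ℤ)⟧)
    (hT : Triangle.mk ((singleFunctor C 0).map f) ((singleFunctor C 0).map g) δ ∈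
      distTriang (DerivedCategory C)) :
    ∃ z : f ≫ g = 0, (ShortComplex.mk f g z).ShortExact := by
  have vanish : ∀ (Z W : C) (t : ((singleFunctor C 0).obj Z)⟦(1 : ℤ)⟧ ⟶
      (singleFunctor C 0).obj W), t = 0 := by
    intro Z W t
    have : TStructure.t.IsLE (((singleFunctor C 0).obj Z)⟦(1 : ℤ)⟧) (-1) :=
      TStructure.t.isLE_shift _ 0 1 (-1)
    exact TStructure.t.zero t (-1) 0 (by lia)
  have hz : f ≫ g = 0 := (singleFunctor C 0).map_injective (by
    rw [Functor.map_comp, Functor.map_zero]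
    exact comp_distTriang_mor_zero₁₂ _ hT)
  have hf : Mono f := by
    refine Preadditive.mono_of_cancel_zero _ fun {Z} u hu => ?_
    obtain ⟨t, ht⟩ := Triangle.coyoneda_exact₁ _ hT (((singleFunctor C 0).map u)⟦(1 : ℤ)⟧') (by
      change ((singleFunctor C 0).map u)⟦(1 : ℤ)⟧' ≫ ((singleFunctor C 0).map f)⟦(1 : ℤ)⟧' = 0
      refine ((shiftFunctor _ _).map_comp _ _).symm.trans ?_
      rw [← Functor.map_comp, hu, Functor.map_zero, Functor.map_zero])
    rw [show t = 0 from vanish _ _ t, zero_comp] at ht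
    apply (singleFunctor C 0).map_injective
    apply (shiftFunctor (DerivedCategory C) (1 : ℤ)).map_injective
    simpa using! ht
  have hg : Epi g := by
    refine Preadditive.epi_of_cancel_zero _ fun {Z} u hu => ?_
    obtain ⟨t, ht⟩ := Triangle.yoneda_exact₃ _ hT ((singleFunctor C 0).map u) (by
      change (singleFunctor C 0).map g ≫ _ = 0
      rw [← Functor.map_comp, hu, Functor.map_zero])
    rw [show t = 0 from vanish _ _ t, comp_zero] at ht
    exact (singleFunctor C 0).map_injective (by simpa using! ht)
  refine ⟨hz, ShortComplex.ShortExact.mk' ?_ hf hg⟩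
  apply ShortComplex.exact_of_f_is_kernel
  refine KernelFork.IsLimit.ofι' f hz fun {Z} k hk => ?_
  have h : ∃ l : Z ⟶ B, l ≫ f = k := by
    obtain ⟨t, ht⟩ := Triangle.coyoneda_exact₂ _ hT ((singleFunctor C 0).map k) (by
      change _ ≫ (singleFunctor C 0).map g = 0
      rw [← Functor.map_comp, hk, Functor.map_zero])
    obtain ⟨l, rfl⟩ := (singleFunctor C 0).map_surjective t
    refine ⟨l, (singleFunctor C 0).map_injective ?_⟩
    rw [Functor.map_comp]
    exact ht.symm
  exact ⟨h.choose, h.choose_spec⟩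

/-- Every class in `Ext¹` comes from an extension: the cocone of the corresponding morphism
`A ⟶ B[1]` of the derived category is concentrated in degree `0`, hence is an object of `C`. -/
theorem exists_shortExact_extClass_eq [HasExt.{w} C] {A B : C} (e : Ext.{w} A B 1) :
    ∃ (E : C) (f : B ⟶ E) (g : E ⟶ A) (z : f ≫ g = 0)
      (h : (ShortComplex.mk f g z).ShortExact), h.extClass = e := by
  let := HasDerivedCategory.standard C
  obtain ⟨Z, f', g', hT⟩ := distinguished_cocone_triangle₂
    (show (singleFunctor C 0).obj A ⟶ ((singleFunctor C 0).obj B)⟦(1 : ℤ)⟧ from e.hom)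
  have : Z.IsLE 0 := TStructure.t.isLE₂ _ hT 0 (inferInstanceAs
    (((singleFunctor C 0).obj B).IsLE 0)) (inferInstanceAs (((singleFunctor C 0).obj A).IsLE 0))
  have : Z.IsGE 0 := TStructure.t.isGE₂ _ hT 0 (inferInstanceAs
    (((singleFunctor C 0).obj B).IsGE 0)) (inferInstanceAs (((singleFunctor C 0).obj A).IsGE 0))
  obtain ⟨E, ⟨a⟩⟩ := exists_iso_singleFunctor_obj_of_isGE_of_isLE Z 0
  obtain ⟨f, hf⟩ := (singleFunctor C 0).map_surjective (f' ≫ a.hom)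
  obtain ⟨g, hg⟩ := (singleFunctor C 0).map_surjective (a.inv ≫ g')
  have hT' : Triangle.mk ((singleFunctor C 0).map f) ((singleFunctor C 0).map g)
      (show (singleFunctor C 0).obj A ⟶ ((singleFunctor C 0).obj B)⟦(1 : ℤ)⟧ from e.hom) ∈
        distTriang (DerivedCategory C) := by
    refine isomorphic_distinguished _ hT _
      (Triangle.isoMk _ _ (Iso.refl _) a.symm (Iso.refl _) ?_ ?_ ?_)
    · change (singleFunctor C 0).map f ≫ a.inv = 𝟙 ((singleFunctor C 0).obj B) ≫ f'
      simp [hf]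
    · change (singleFunctor C 0).map g ≫ 𝟙 ((singleFunctor C 0).obj A) = a.inv ≫ g'
      simp [hg]
    · change e.hom ≫ (𝟙 ((singleFunctor C 0).obj B))⟦(1 : ℤ)⟧' =
        𝟙 ((singleFunctor C 0).obj A) ≫ e.hom
      rw [CategoryTheory.Functor.map_id, Category.id_comp]
      exact Category.comp_id _
  obtain ⟨z, h⟩ := shortExact_of_singleFunctor_distTriang f g _ hT'
  refine ⟨E, f, g, z, h, ?_⟩
  obtain ⟨c, hc1, hc2⟩ := complete_distinguished_triangle_morphism _ _
    h.singleTriangle_distinguished hT'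
    (𝟙 ((singleFunctor C 0).obj B)) (𝟙 ((singleFunctor C 0).obj E)) (by
      change (singleFunctor C 0).map f ≫ 𝟙 ((singleFunctor C 0).obj E) =
        𝟙 ((singleFunctor C 0).obj B) ≫ (singleFunctor C 0).map f
      simp)
  obtain ⟨c, rfl⟩ := (singleFunctor C 0).map_surjective c
  have := h.epi_g
  -- the triangle of the short exact sequence has the same first two morphisms, hence also the same
  -- third one, since `g` is an epimorphism
  have hc : c = 𝟙 A := by
    rw [← cancel_epi g]
    apply (singleFunctor C 0).map_injective
    rw [Functor.map_comp, Category.comp_id]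
    exact hc1.trans (Category.id_comp _)
  subst hc
  ext
  rw [ShortComplex.ShortExact.extClass_hom]
  have hc3 : h.singleδ ≫ (𝟙 ((singleFunctor C 0).obj B))⟦(1 : ℤ)⟧' =
      (singleFunctor C 0).map (𝟙 A) ≫ e.hom := hc2
  rw [CategoryTheory.Functor.map_id, CategoryTheory.Functor.map_id, Category.id_comp] at hc3
  exact (Category.comp_id _).symm.trans hc3

end Realization

/-! ### Isomorphism classes and short exact sequences -/

namespace IsoClass

variable {C : Type u} [Category.{v} C]

/-- The isomorphism class of an object. -/
def of (M : C) : IsoClass C := Quotient.mk (isIsomorphicSetoid C) M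

theorem of_eq_of_iff {M N : C} : of M = of N ↔ Nonempty (M ≅ N) := Quotient.eq

theorem of_eq_of {M N : C} (e : M ≅ N) : of M = of N := of_eq_of_iff.2 ⟨e⟩

@[simp]
theorem of_rep (α : IsoClass C) : of α.rep = α := Quotient.out_eq α

theorem nonempty_rep_iso (M : C) : Nonempty ((of M).rep ≅ M) := of_eq_of_iff.1 (of_rep _)

theorem of_eq_iff {M : C} {α : IsoClass C} : of M = α ↔ Nonempty (M ≅ α.rep) := by
  rw [← of_eq_of_iff, of_rep]

end IsoClass

section Extensions

variable {C : Type u} [Category.{v} C] [Abelian C]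

/-- The sequence `0 ⟶ B ⟶ M ⟶ A ⟶ 0` given by `f` and `g` is short exact. -/
def IsSES {B M A : C} (f : B ⟶ M) (g : M ⟶ A) : Prop :=
  ∃ z : f ≫ g = 0, (ShortComplex.mk f g z).ShortExact

namespace IsSES

variable {B M A B' M' A' : C} {f : B ⟶ M} {g : M ⟶ A} {f' : B' ⟶ M'} {g' : M' ⟶ A'}

theorem zero (h : IsSES f g) : f ≫ g = 0 := h.1

theorem mono (h : IsSES f g) : Mono f := h.2.mono_f

theorem epi (h : IsSES f g) : Epi g := h.2.epi_g

theorem exists_lift (h : IsSES f g) {Z : C} (k : Z ⟶ M) (hk : k ≫ g = 0) : ∃ l, l ≫ f = k :=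
  have := h.mono
  ⟨h.2.exact.lift k hk, h.2.exact.lift_f k hk⟩

theorem exists_desc (h : IsSES f g) {Z : C} (k : M ⟶ Z) (hk : f ≫ k = 0) : ∃ l, g ≫ l = k :=
  have := h.epi
  ⟨h.2.exact.desc k hk, h.2.exact.g_desc k hk⟩

theorem of_kernel (g : M ⟶ A) [Epi g] : IsSES (kernel.ι g) g :=
  ⟨kernel.condition g, ShortComplex.ShortExact.mk' (ShortComplex.exact_kernel g) inferInstance
    inferInstance⟩

theorem of_cokernel (f : B ⟶ M) [Mono f] : IsSES f (cokernel.π f) :=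
  ⟨cokernel.condition f, ShortComplex.ShortExact.mk' (ShortComplex.exact_cokernel f) inferInstance
    inferInstance⟩

theorem of_iso (h : IsSES f g) (b : B ≅ B') (m : M ≅ M') (a : A ≅ A')
    (h₁ : b.hom ≫ f' = f ≫ m.hom) (h₂ : m.hom ≫ g' = g ≫ a.hom) : IsSES f' g' := by
  have z : f' ≫ g' = 0 := by
    rw [← cancel_epi b.hom, ← Category.assoc, h₁, Category.assoc, h₂, ← Category.assoc, h.zero,
      zero_comp, comp_zero]
  exact ⟨z, ShortComplex.shortExact_of_iso
    (ShortComplex.isoMk (S₁ := ShortComplex.mk f g h.1) (S₂ := ShortComplex.mk f' g' z)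
      b m a h₁ h₂) h.2⟩

/-- A map of short exact sequences that is invertible at the ends is invertible. -/
theorem isIso_of_comm {M' : C} {f' : B ⟶ M'} {g' : M' ⟶ A} (h : IsSES f g) (h' : IsSES f' g')
    (t : M ⟶ M') (h₁ : f ≫ t = f') (h₂ : t ≫ g' = g) : IsIso t := by
  let s : ShortComplex.mk f g h.1 ⟶ ShortComplex.mk f' g' h'.1 :=
    { τ₁ := 𝟙 B, τ₂ := t, τ₃ := 𝟙 A
      comm₁₂ := by simp [h₁]
      comm₂₃ := by simp [h₂] }
  have : IsIso s.τ₁ := inferInstanceAs (IsIso (𝟙 B))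
  have : IsIso s.τ₃ := inferInstanceAs (IsIso (𝟙 A))
  exact ShortComplex.isIso₂_of_shortExact_of_isIso₁₃ s h.2 h'.2

theorem exists_iso_left {f' : B' ⟶ M} (h : IsSES f g) (h' : IsSES f' g) :
    ∃ t : B ≅ B', t.hom ≫ f' = f := by
  have := h.mono
  have := h'.mono
  obtain ⟨s, hs⟩ := h'.exists_lift f h.zero
  obtain ⟨t, ht⟩ := h.exists_lift f' h'.zero
  exact ⟨⟨s, t, by rw [← cancel_mono f, Category.assoc, ht, hs, Category.id_comp],
    by rw [← cancel_mono f', Category.assoc, hs, ht, Category.id_comp]⟩, hs⟩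

theorem exists_iso_right {g' : M ⟶ A'} (h : IsSES f g) (h' : IsSES f g') :
    ∃ t : A ≅ A', g ≫ t.hom = g' := by
  have := h.epi
  have := h'.epi
  obtain ⟨s, hs⟩ := h.exists_desc g' h'.zero
  obtain ⟨t, ht⟩ := h'.exists_desc g h.zero
  exact ⟨⟨s, t, by rw [← cancel_epi g, ← Category.assoc, hs, ht, Category.comp_id],
    by rw [← cancel_epi g', ← Category.assoc, ht, hs, Category.comp_id]⟩, hs⟩

variable [HasExt.{w} C]

/-- The class in `Ext¹(A, B)` of a short exact sequence. -/
noncomputable def cls (h : IsSES f g) : Ext.{w} A B 1 := h.2.extClass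

theorem cls_naturality (h : IsSES f g) (h' : IsSES f' g') (b : B ⟶ B') (m : M ⟶ M') (a : A ⟶ A')
    (h₁ : b ≫ f' = f ≫ m) (h₂ : m ≫ g' = g ≫ a) :
    (cls.{w} h).comp (Ext.mk₀ b) (add_zero 1) = (Ext.mk₀ a).comp (cls.{w} h') (zero_add 1) :=
  let t : ShortComplex.mk f g h.1 ⟶ ShortComplex.mk f' g' h'.1 :=
    { τ₁ := b, τ₂ := m, τ₃ := a
      comm₁₂ := h₁
      comm₂₃ := h₂ }
  ShortComplex.ShortExact.extClass_naturality h.2 h'.2 t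

theorem cls_eq_of_comm {M' : C} {f' : B ⟶ M'} {g' : M' ⟶ A} (h : IsSES f g) (h' : IsSES f' g')
    (m : M ⟶ M') (h₁ : f ≫ m = f') (h₂ : m ≫ g' = g) : cls.{w} h = cls.{w} h' := by
  simpa using cls_naturality.{w} h h' (𝟙 _) m (𝟙 _) (by simp [h₁]) (by simp [h₂])

/-- Short exact sequences with the same class are isomorphic by an isomorphism that is the identity
at both ends. -/
theorem exists_iso_of_cls_eq {M' : C} {f' : B ⟶ M'} {g' : M' ⟶ A} (h : IsSES f g)
    (h' : IsSES f' g') (e : cls.{w} h = cls.{w} h') :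
    ∃ m : M ≅ M', f ≫ m.hom = f' ∧ m.hom ≫ g' = g := by
  have hc' : (cls.{w} h').comp (Ext.mk₀ f') (add_zero 1) = 0 := h'.2.extClass_comp
  obtain ⟨x, hx⟩ := Ext.contravariant_sequence_exact₁ h.2 M' (Ext.mk₀ f') (n₁ := 1) rfl
    ((congrArg (fun c => Ext.comp c (Ext.mk₀ f') (add_zero 1)) e).trans hc')
  obtain ⟨φ, rfl⟩ := (Ext.mk₀_bijective _ _).2 x
  have hφ : f ≫ φ = f' := by
    rw [Ext.mk₀_comp_mk₀] at hx
    exact (Ext.mk₀_bijective _ _).1 hx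
  obtain ⟨p, hp⟩ := h.exists_desc (φ ≫ g') (by rw [← Category.assoc, hφ, h'.zero])
  have hnat := cls_naturality.{w} h h' (𝟙 B) φ p (by simp [hφ]) hp.symm
  have hker : (Ext.mk₀ (p - 𝟙 A)).comp (cls.{w} h') (zero_add 1) = 0 := by
    have h1 : Ext.mk₀ p = Ext.mk₀ (p - 𝟙 A) + Ext.mk₀ (𝟙 A) := by
      rw [← Ext.mk₀_add, sub_add_cancel]
    rw [h1, Ext.add_comp, Ext.comp_mk₀_id, Ext.mk₀_id_comp, e] at hnat
    exact right_eq_add.1 hnat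
  obtain ⟨y, hy⟩ := Ext.covariant_sequence_exact₃ A h'.2 (Ext.mk₀ (p - 𝟙 A)) (n₁ := 1) rfl hker
  obtain ⟨s, rfl⟩ := (Ext.mk₀_bijective _ _).2 y
  have hs : s ≫ g' = p - 𝟙 A := by
    rw [Ext.mk₀_comp_mk₀] at hy
    exact (Ext.mk₀_bijective _ _).1 hy
  have h₁ : f ≫ (φ - g ≫ s) = f' := by
    rw [Preadditive.comp_sub, ← Category.assoc f, h.zero, zero_comp, sub_zero, hφ]
  have h₂ : (φ - g ≫ s) ≫ g' = g := by simp [Preadditive.sub_comp, ← hp, hs]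
  have := isIso_of_comm h h' _ h₁ h₂
  exact ⟨asIso (φ - g ≫ s), h₁, h₂⟩

end IsSES

/-- The set of short exact sequences `0 ⟶ B ⟶ M ⟶ A ⟶ 0` on three fixed objects. -/
def Extension (A B M : C) : Type v := {p : (B ⟶ M) × (M ⟶ A) // IsSES p.1 p.2}

namespace Extension

variable {A B M : C}

/-- The inclusion of the subobject. -/
def f (x : Extension A B M) : B ⟶ M := x.1.1

/-- The projection to the quotient. -/
def g (x : Extension A B M) : M ⟶ A := x.1.2

/-- A short exact sequence as an element of the set of all of them. -/
def mk {f : B ⟶ M} {g : M ⟶ A} (h : IsSES f g) : Extension A B M := ⟨(f, g), h⟩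

@[simp]
theorem mk_f {f : B ⟶ M} {g : M ⟶ A} (h : IsSES f g) : (mk h).f = f := rfl

@[simp]
theorem mk_g {f : B ⟶ M} {g : M ⟶ A} (h : IsSES f g) : (mk h).g = g := rfl

theorem isSES (x : Extension A B M) : IsSES x.f x.g := x.2

@[ext]
theorem ext {x y : Extension A B M} (h₁ : x.f = y.f) (h₂ : x.g = y.g) : x = y :=
  Subtype.ext (Prod.ext h₁ h₂)

/-- The class of a short exact sequence. -/
noncomputable def cls [HasExt.{w} C] (x : Extension A B M) : Ext.{w} A B 1 := x.isSES.cls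

instance [∀ X Y : C, Finite (X ⟶ Y)] : Finite (Extension A B M) :=
  inferInstanceAs (Finite {p : (B ⟶ M) × (M ⟶ A) // IsSES p.1 p.2})

end Extension

instance finite_aut [∀ X Y : C, Finite (X ⟶ Y)] (M : C) : Finite (Aut M) :=
  Finite.of_injective (fun a : Aut M => a.hom) fun _ _ h => Iso.ext h

instance finite_iso [∀ X Y : C, Finite (X ⟶ Y)] (M N : C) : Finite (M ≅ N) :=
  Finite.of_injective (fun a : M ≅ N => a.hom) fun _ _ h => Iso.ext h

theorem Nat.card_eq_mul_of_card_fiber {α β : Type*} [Finite β] (φ : α → β) (n : ℕ)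
    (h : ∀ b, Nat.card {a // φ a = b} = n) [Finite α] : Nat.card α = Nat.card β * n := by
  have := Fintype.ofFinite β
  rw [← Nat.card_congr (Equiv.sigmaFiberEquiv φ), Nat.card_sigma]
  simp [h]

/-! ### Counting short exact sequences with a given class -/

section Counting

variable [HasExt.{w} C]

/-- The isomorphism class of the middle term of an extension with a given class. -/
noncomputable def midClass {A B : C} (e : Ext.{w} A B 1) : IsoClass C :=
  IsoClass.of (exists_shortExact_extClass_eq e).choose

theorem exists_extension {A B : C} (e : Ext.{w} A B 1) :
    ∃ w : Extension A B (midClass e).rep, w.cls = e := by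
  obtain ⟨f, g, z, h, he⟩ := (exists_shortExact_extClass_eq e).choose_spec
  obtain ⟨i⟩ := IsoClass.nonempty_rep_iso (exists_shortExact_extClass_eq e).choose
  have hs : IsSES f g := ⟨z, h⟩
  have hs' : IsSES (f ≫ i.inv) (i.hom ≫ g) :=
    hs.of_iso (Iso.refl _) i.symm (Iso.refl _) (by simp) (by simp)
  exact ⟨.mk hs',
    (IsSES.cls_eq_of_comm.{w} hs hs' i.inv rfl (by simp)).symm.trans he⟩

theorem midClass_cls {A B M : C} {f : B ⟶ M} {g : M ⟶ A} (h : IsSES f g) :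
    midClass (IsSES.cls.{w} h) = IsoClass.of M := by
  obtain ⟨w, hw⟩ := exists_extension (IsSES.cls.{w} h)
  obtain ⟨i, -⟩ := IsSES.exists_iso_of_cls_eq.{w} w.isSES h hw
  rw [← IsoClass.of_rep (midClass _)]
  exact IsoClass.of_eq_of i

/-- The isomorphisms between two equivalent extensions of `A` by `B` are a torsor under
`Hom(A, B)`. -/
theorem card_equivalences {A B M : C} (x y : Extension A B M) (h : Extension.cls.{w} x = y.cls) :
    Nat.card {t : M ≅ M // x.f ≫ t.hom = y.f ∧ t.hom ≫ y.g = x.g} = Nat.card (A ⟶ B) := by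
  obtain ⟨t₀, h₁, h₂⟩ := IsSES.exists_iso_of_cls_eq.{w} x.isSES y.isSES h
  have := x.isSES.epi
  have := y.isSES.mono
  have c₁ (k : A ⟶ B) : x.f ≫ (t₀.hom + x.g ≫ k ≫ y.f) = y.f := by
    rw [Preadditive.comp_add, h₁, ← Category.assoc x.f x.g, x.isSES.zero, zero_comp, add_zero]
  have c₂ (k : A ⟶ B) : (t₀.hom + x.g ≫ k ≫ y.f) ≫ y.g = x.g := by
    simp [Preadditive.add_comp, h₂, y.isSES.zero]
  have c₃ (k : A ⟶ B) : IsIso (t₀.hom + x.g ≫ k ≫ y.f) :=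
    IsSES.isIso_of_comm x.isSES y.isSES _ (c₁ k) (c₂ k)
  refine (Nat.card_eq_of_bijective
    (fun k : A ⟶ B => (⟨asIso (t₀.hom + x.g ≫ k ≫ y.f), c₁ k, c₂ k⟩ :
      {t : M ≅ M // x.f ≫ t.hom = y.f ∧ t.hom ≫ y.g = x.g})) ⟨fun k l hkl => ?_, ?_⟩).symm
  · have := congrArg (fun t => t.1.hom) hkl
    simpa [cancel_epi, cancel_mono] using this
  · rintro ⟨t, h₃, h₄⟩
    obtain ⟨l, hl⟩ := x.isSES.exists_desc (t.hom - t₀.hom) (by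
      rw [Preadditive.comp_sub, h₁, h₃, sub_self])
    obtain ⟨k, hk⟩ := y.isSES.exists_lift l (by
      rw [← cancel_epi x.g, ← Category.assoc, hl, Preadditive.sub_comp, h₂, h₄]; simp)
    exact ⟨k, Subtype.ext (Iso.ext (by simp [hk, hl]))⟩

variable [∀ X Y : C, Finite (X ⟶ Y)]

/-- The group `Aut M` acts transitively on the short exact sequences with middle term `M` and a
given class, with stabilizers isomorphic to `Hom(A, B)`. -/
theorem card_extension_fiber_mul {A B : C} {γ : IsoClass C} (e : Ext.{w} A B 1)
    (h : midClass e = γ) :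
    Nat.card {x : Extension A B γ.rep // x.cls = e} * Nat.card (A ⟶ B) = autCard γ := by
  subst h
  obtain ⟨x, hx⟩ := exists_extension e
  have hs (t : (midClass e).rep ≅ (midClass e).rep) : IsSES (x.f ≫ t.hom) (t.inv ≫ x.g) :=
    x.isSES.of_iso (Iso.refl _) t (Iso.refl _) (by simp) (by simp)
  refine (Nat.card_eq_mul_of_card_fiber (fun t : (midClass e).rep ≅ (midClass e).rep =>
    (⟨.mk (hs t),
      (IsSES.cls_eq_of_comm.{w} x.isSES (hs t) t.hom rfl (by simp)).symm.trans hx⟩ :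
      {x : Extension A B (midClass e).rep // x.cls = e})) _ ?_).symm
  rintro ⟨y, hy⟩
  rw [← card_equivalences.{w} x y (hx.trans hy.symm)]
  refine Nat.card_congr (Equiv.subtypeEquivRight fun t => ?_)
  refine Subtype.ext_iff.trans ?_
  rw [Extension.ext_iff, Extension.mk_f, Extension.mk_g, Iso.inv_comp_eq,
    eq_comm (a := x.g)]

end Counting

end Extensions

/-! ### Riedtmann's formula and weighted sums over morphisms -/

section WeightedCounts

variable {C : Type u} [Category.{v} C] [Abelian C]

/-- Sums over finite Hom sets. -/
noncomputable instance fintypeHom [∀ X Y : C, Finite (X ⟶ Y)] (X Y : C) : Fintype (X ⟶ Y) :=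
  Fintype.ofFinite _

/-- Sums over the finite sets of short exact sequences on given objects. -/
noncomputable instance fintypeExtension [∀ X Y : C, Finite (X ⟶ Y)] (A B M : C) :
    Fintype (Extension A B M) :=
  Fintype.ofFinite _

/-- Sums over finite `Ext¹` groups. -/
noncomputable instance fintypeExt [HasExt.{w} C] [∀ X Y : C, Finite (Ext.{w} X Y 1)] (X Y : C) :
    Fintype (Ext.{w} X Y 1) :=
  Fintype.ofFinite _

variable [∀ X Y : C, Finite (X ⟶ Y)]

omit [Abelian C] in
theorem autCard_pos (α : IsoClass C) : 0 < autCard α := Nat.card_pos (α := Aut α.rep)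

omit [Abelian C] in
theorem autCard_ne_zero (α : IsoClass C) : (autCard α : ℝ) ≠ 0 :=
  Nat.cast_ne_zero.2 (autCard_pos α).ne'

omit [Abelian C] [∀ X Y : C, Finite (X ⟶ Y)] in
theorem card_iso_eq_autCard {M N : C} {α : IsoClass C} (hM : IsoClass.of M = α)
    (hN : IsoClass.of N = α) : Nat.card (M ≅ N) = autCard α := by
  obtain ⟨i⟩ := IsoClass.of_eq_iff.1 hM
  obtain ⟨j⟩ := IsoClass.of_eq_iff.1 hN
  have e : (M ≅ N) ≃ (α.rep ≅ α.rep) :=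
    { toFun := fun t => i.symm ≪≫ t ≪≫ j
      invFun := fun t => i ≪≫ t ≪≫ j.symm
      left_inv := fun t => by ext; simp
      right_inv := fun t => by ext; simp }
  exact Nat.card_congr e

omit [∀ X Y : C, Finite (X ⟶ Y)] in
/-- The sequences with given projection `g` are the isomorphisms onto the kernel of `g`. -/
theorem card_extension_g {A X M : C} (g : M ⟶ A) [Epi g] :
    Nat.card {x : Extension A X M // x.g = g} = Nat.card (kernel g ≅ X) := by
  have hs (t : kernel g ≅ X) : IsSES (t.inv ≫ kernel.ι g) g :=
    (IsSES.of_kernel g).of_iso t (Iso.refl _) (Iso.refl _) (by simp) (by simp)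
  refine (Nat.card_eq_of_bijective (fun t : kernel g ≅ X =>
    (⟨.mk (hs t), rfl⟩ : {x : Extension A X M // x.g = g})) ⟨fun s t h => ?_, ?_⟩).symm
  · have := congrArg (fun x => x.1.f) h
    exact Iso.symm_eq_iff.1 (Iso.ext ((cancel_mono (kernel.ι g)).1 this))
  · rintro ⟨x, rfl⟩
    obtain ⟨t, ht⟩ := x.isSES.exists_iso_left (IsSES.of_kernel x.g)
    exact ⟨t.symm, Subtype.ext (Extension.ext ht rfl)⟩

omit [∀ X Y : C, Finite (X ⟶ Y)] in
/-- The sequences with given inclusion `f` are the isomorphisms from the cokernel of `f`. -/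
theorem card_extension_f {X B M : C} (f : B ⟶ M) [Mono f] :
    Nat.card {x : Extension X B M // x.f = f} = Nat.card (cokernel f ≅ X) := by
  have hs (t : cokernel f ≅ X) : IsSES f (cokernel.π f ≫ t.hom) :=
    (IsSES.of_cokernel f).of_iso (Iso.refl _) (Iso.refl _) t (by simp) (by simp)
  refine (Nat.card_eq_of_bijective (fun t : cokernel f ≅ X =>
    (⟨.mk (hs t), rfl⟩ : {x : Extension X B M // x.f = f})) ⟨fun s t h => ?_, ?_⟩).symm
  · have := congrArg (fun x => x.1.g) h
    exact Iso.ext ((cancel_epi (cokernel.π f)).1 this)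
  · rintro ⟨x, rfl⟩
    obtain ⟨t, ht⟩ := (IsSES.of_cokernel x.f).exists_iso_right x.isSES
    exact ⟨t, Subtype.ext (Extension.ext rfl ht)⟩

/-- A sum over epimorphisms `M ⟶ A` as a weighted sum over the short exact sequences that they
are part of: every epimorphism is part of `|Aut X|` sequences for exactly one class `X`. -/
theorem sum_epi_eq {A M : C} (D : Finset (IsoClass C)) (F : (M ⟶ A) → ℝ)
    (hF : ∀ g, F g ≠ 0 → Epi g ∧ IsoClass.of (kernel g) ∈ D) :
    ∑ g, F g = ∑ X ∈ D, (autCard X : ℝ)⁻¹ * ∑ x : Extension A X.rep M, F x.g := by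
  classical
  have key (X : IsoClass C) : ∑ x : Extension A X.rep M, F x.g =
      ∑ g : M ⟶ A, if X = IsoClass.of (kernel g) then autCard X * F g else 0 := by
    rw [← Fintype.sum_fiberwise (fun x : Extension A X.rep M => x.g)]
    refine Finset.sum_congr rfl fun g _ => ?_
    rw [Finset.sum_congr rfl (g := fun _ => F g) (by rintro ⟨x, rfl⟩ -; rfl), Finset.sum_const,
      Finset.card_univ, nsmul_eq_mul, ← Nat.card_eq_fintype_card]
    rcases eq_or_ne (F g) 0 with h0 | h0
    · simp [h0]
    have := (hF g h0).1
    rw [card_extension_g]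
    split_ifs with h
    · rw [card_iso_eq_autCard h.symm (IsoClass.of_rep X)]
    · have : IsEmpty (kernel g ≅ X.rep) := ⟨fun i => h (IsoClass.of_eq_iff.2 ⟨i⟩).symm⟩
      simp
  simp_rw [key, Finset.mul_sum]
  rw [Finset.sum_comm]
  refine Finset.sum_congr rfl fun g _ => ?_
  rcases eq_or_ne (F g) 0 with h0 | h0
  · simp [h0]
  simp only [mul_ite, mul_zero, Finset.sum_ite_eq', (hF g h0).2, if_true]
  rw [inv_mul_cancel_left₀ (autCard_ne_zero _)]

/-- The dual of `sum_epi_eq`. -/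
theorem sum_mono_eq {B M : C} (D : Finset (IsoClass C)) (F : (B ⟶ M) → ℝ)
    (hF : ∀ f, F f ≠ 0 → Mono f ∧ IsoClass.of (cokernel f) ∈ D) :
    ∑ f, F f = ∑ X ∈ D, (autCard X : ℝ)⁻¹ * ∑ x : Extension X.rep B M, F x.f := by
  classical
  have key (X : IsoClass C) : ∑ x : Extension X.rep B M, F x.f =
      ∑ f : B ⟶ M, if X = IsoClass.of (cokernel f) then autCard X * F f else 0 := by
    rw [← Fintype.sum_fiberwise (fun x : Extension X.rep B M => x.f)]
    refine Finset.sum_congr rfl fun f _ => ?_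
    rw [Finset.sum_congr rfl (g := fun _ => F f) (by rintro ⟨x, rfl⟩ -; rfl), Finset.sum_const,
      Finset.card_univ, nsmul_eq_mul, ← Nat.card_eq_fintype_card]
    rcases eq_or_ne (F f) 0 with h0 | h0
    · simp [h0]
    have := (hF f h0).1
    rw [card_extension_f]
    split_ifs with h
    · rw [card_iso_eq_autCard h.symm (IsoClass.of_rep X)]
    · have : IsEmpty (cokernel f ≅ X.rep) := ⟨fun i => h (IsoClass.of_eq_iff.2 ⟨i⟩).symm⟩
      simp
  simp_rw [key, Finset.mul_sum]
  rw [Finset.sum_comm]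
  refine Finset.sum_congr rfl fun f _ => ?_
  rcases eq_or_ne (F f) 0 with h0 | h0
  · simp [h0]
  simp only [mul_ite, mul_zero, Finset.sum_ite_eq', (hF f h0).2, if_true]
  rw [inv_mul_cancel_left₀ (autCard_ne_zero _)]

variable [HasExt.{w} C] [∀ X Y : C, Finite (Ext.{w} X Y 1)]

/-- Riedtmann's formula: the short exact sequences `0 ⟶ B ⟶ M ⟶ A ⟶ 0`, weighted by
`1 / |Aut M|`, are distributed over the classes in `Ext¹(A, B)` with the constant density
`1 / |Hom(A, B)|`. -/
theorem sum_extension_eq {A B : C} (T : Finset (IsoClass C)) (φ : Ext.{w} A B 1 → ℝ)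
    (hT : ∀ e, φ e ≠ 0 → midClass e ∈ T) :
    ∑ M ∈ T, (autCard M : ℝ)⁻¹ * ∑ x : Extension A B M.rep, φ x.cls =
      (Nat.card (A ⟶ B) : ℝ)⁻¹ * ∑ e, φ e := by
  classical
  have hAB : (Nat.card (A ⟶ B) : ℝ) ≠ 0 := Nat.cast_ne_zero.2 Nat.card_pos.ne'
  have key (M : IsoClass C) : ∑ x : Extension A B M.rep, φ x.cls =
      ∑ e, if M = midClass e then autCard M * ((Nat.card (A ⟶ B) : ℝ)⁻¹ * φ e) else 0 := by
    rw [← Fintype.sum_fiberwise (fun x : Extension A B M.rep => x.cls)]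
    refine Finset.sum_congr rfl fun e _ => ?_
    rw [Finset.sum_congr rfl (g := fun _ => φ e) (by rintro ⟨x, rfl⟩ -; rfl), Finset.sum_const,
      Finset.card_univ, nsmul_eq_mul, ← Nat.card_eq_fintype_card]
    split_ifs with h
    · rw [← card_extension_fiber_mul e h.symm]
      push_cast
      field_simp
    · have : IsEmpty {x : Extension A B M.rep // x.cls = e} := by
        refine ⟨fun x => h ?_⟩
        rw [← x.2]
        exact ((midClass_cls.{w} x.1.isSES).trans (IsoClass.of_rep M)).symm
      simp
  simp_rw [key, Finset.mul_sum]
  rw [Finset.sum_comm]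
  refine Finset.sum_congr rfl fun e _ => ?_
  rcases eq_or_ne (φ e) 0 with h0 | h0
  · simp [h0]
  simp only [mul_ite, mul_zero, Finset.sum_ite_eq', hT e h0, if_true]
  rw [inv_mul_cancel_left₀ (autCard_ne_zero _)]

/-- A weighted sum over all epimorphisms onto `A`, computed in the extensions of `A`. -/
theorem sum_sum_epi_eq {A : C} (T D : Finset (IsoClass C))
    (F : ∀ M : IsoClass C, (M.rep ⟶ A) → ℝ) (Φ : ∀ X : IsoClass C, Ext.{w} A X.rep 1 → ℝ)
    (hF : ∀ M g, F M g ≠ 0 → Epi g ∧ IsoClass.of (kernel g) ∈ D)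
    (hΦ : ∀ X M, ∀ x : Extension A X.rep M.rep, F M x.g = Φ X x.cls)
    (hT : ∀ X ∈ D, ∀ e, Φ X e ≠ 0 → midClass e ∈ T) :
    ∑ M ∈ T, (autCard M : ℝ)⁻¹ * ∑ g, F M g =
      ∑ X ∈ D, (autCard X : ℝ)⁻¹ * ((Nat.card (A ⟶ X.rep) : ℝ)⁻¹ * ∑ e, Φ X e) := by
  simp_rw [fun M => sum_epi_eq D (F M) (hF M), hΦ, Finset.mul_sum (s := D)]
  rw [Finset.sum_comm]
  refine Finset.sum_congr rfl fun X hX => ?_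
  rw [← sum_extension_eq T (Φ X) (hT X hX), Finset.mul_sum (s := T)]
  exact Finset.sum_congr rfl fun M _ => mul_left_comm _ _ _

/-- The dual of `sum_sum_epi_eq`. -/
theorem sum_sum_mono_eq {B : C} (T D : Finset (IsoClass C))
    (F : ∀ M : IsoClass C, (B ⟶ M.rep) → ℝ) (Φ : ∀ X : IsoClass C, Ext.{w} X.rep B 1 → ℝ)
    (hF : ∀ M f, F M f ≠ 0 → Mono f ∧ IsoClass.of (cokernel f) ∈ D)
    (hΦ : ∀ X M, ∀ x : Extension X.rep B M.rep, F M x.f = Φ X x.cls)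
    (hT : ∀ X ∈ D, ∀ e, Φ X e ≠ 0 → midClass e ∈ T) :
    ∑ M ∈ T, (autCard M : ℝ)⁻¹ * ∑ f, F M f =
      ∑ X ∈ D, (autCard X : ℝ)⁻¹ * ((Nat.card (X.rep ⟶ B) : ℝ)⁻¹ * ∑ e, Φ X e) := by
  simp_rw [fun M => sum_mono_eq D (F M) (hF M), hΦ, Finset.mul_sum (s := D)]
  rw [Finset.sum_comm]
  refine Finset.sum_congr rfl fun X hX => ?_
  rw [← sum_extension_eq T (Φ X) (hT X hX), Finset.mul_sum (s := T)]
  exact Finset.sum_congr rfl fun M _ => mul_left_comm _ _ _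

end WeightedCounts

/-! ### Subobjects and quotients of extensions -/

section PullPush

variable {C : Type u} [Category.{v} C] [Abelian C]

namespace IsSES

variable {B M A A' A'' B' B'' X Y : C} {f : B ⟶ M} {g : M ⟶ A}

theorem of_isKernel (z : f ≫ g = 0) [Mono f] [Epi g]
    (h : ∀ {Z : C} (k : Z ⟶ M), k ≫ g = 0 → ∃ l, l ≫ f = k) : IsSES f g := by
  refine ⟨z, ShortComplex.ShortExact.mk' (ShortComplex.exact_of_f_is_kernel _ ?_) ‹_› ‹_›⟩
  exact KernelFork.IsLimit.ofι' f z fun k hk => ⟨(h k hk).choose, (h k hk).choose_spec⟩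

theorem op (h : IsSES f g) : IsSES g.op f.op := by
  have z : g.op ≫ f.op = 0 := by rw [← op_comp, h.zero, op_zero]
  exact ⟨z, h.2.op⟩

theorem unop {X Y Z : Cᵒᵖ} {f : X ⟶ Y} {g : Y ⟶ Z} (h : IsSES f g) : IsSES g.unop f.unop := by
  have z : g.unop ≫ f.unop = 0 := by rw [← unop_comp, h.zero, unop_zero]
  exact ⟨z, h.2.unop⟩

/-- The preimage `X` in `M` of a subobject `A'` of the quotient `A = M / B` is an extension of `A'`
by `B`. -/
theorem exists_pull {u' : A' ⟶ A} {p : A ⟶ A''} {i : X ⟶ M} (h : IsSES f g) (h' : IsSES u' p)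
    (hX : IsSES i (g ≫ p)) :
    ∃ (f' : B ⟶ X) (g' : X ⟶ A'), IsSES f' g' ∧ f' ≫ i = f ∧ i ≫ g = g' ≫ u' := by
  have := h.mono
  have := h.epi
  have := h'.mono
  have := hX.mono
  obtain ⟨f', hf'⟩ := hX.exists_lift f (by rw [← Category.assoc, h.zero, zero_comp])
  obtain ⟨g', hg'⟩ := h'.exists_lift (i ≫ g) (by rw [Category.assoc, hX.zero])
  have : Mono (f' ≫ i) := by rw [hf']; infer_instance
  have : Mono f' := mono_of_mono f' i
  have : Epi g' := by
    rw [epi_iff_surjective_up_to_refinements]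
    intro Z a
    obtain ⟨Z', r, hr, m, hm⟩ := surjective_up_to_refinements_of_epi g (a ≫ u')
    obtain ⟨l, hl⟩ := hX.exists_lift m (by
      rw [← Category.assoc, ← hm, Category.assoc, Category.assoc, h'.zero, comp_zero, comp_zero])
    refine ⟨Z', r, hr, l, ?_⟩
    rw [← cancel_mono u', Category.assoc, Category.assoc, hm, hg', ← Category.assoc, hl]
  refine ⟨f', g', of_isKernel ?_ fun k hk => ?_, hf', hg'.symm⟩
  · rw [← cancel_mono u', Category.assoc, hg', ← Category.assoc, hf', h.zero, zero_comp]
  · obtain ⟨l, hl⟩ := h.exists_lift (k ≫ i) (by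
      rw [Category.assoc, ← hg', ← Category.assoc, hk, zero_comp])
    exact ⟨l, by rw [← cancel_mono i, Category.assoc, hf', hl]⟩

/-- The quotient `Y` of `M` by a subobject `B''` of `B` is an extension of `M / B` by `B / B''`. -/
theorem exists_push {u' : B'' ⟶ B} {p : B ⟶ B'} {c : M ⟶ Y} (h : IsSES f g) (h' : IsSES u' p)
    (hY : IsSES (u' ≫ f) c) :
    ∃ (f' : B' ⟶ Y) (g' : Y ⟶ A), IsSES f' g' ∧ c ≫ g' = g ∧ f ≫ c = p ≫ f' := by
  obtain ⟨f', g', h₁, h₂, h₃⟩ := exists_pull h.op h'.op hY.op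
  exact ⟨g'.unop, f'.unop, h₁.unop, Quiver.Hom.op_inj h₂, Quiver.Hom.op_inj h₃⟩

theorem of_kernel_class {g : M ⟶ A} (h : IsSES f g) : IsoClass.of (kernel g) = IsoClass.of B := by
  have := h.epi
  obtain ⟨t, -⟩ := (of_kernel g).exists_iso_left h
  exact IsoClass.of_eq_of t

theorem of_cokernel_class {f : B ⟶ M} (h : IsSES f g) :
    IsoClass.of (cokernel f) = IsoClass.of A := by
  have := h.mono
  obtain ⟨t, -⟩ := (of_cokernel f).exists_iso_right h
  exact IsoClass.of_eq_of t

theorem biprod_inr_fst (X Y : C) : IsSES (biprod.inr : Y ⟶ X ⊞ Y) biprod.fst :=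
  of_isKernel (by simp) fun k hk => ⟨k ≫ biprod.snd, by
    apply biprod.hom_ext
    · simp [hk]
    · simp⟩

theorem biprod_inl_snd (X Y : C) : IsSES (biprod.inl : X ⟶ X ⊞ Y) biprod.snd :=
  of_isKernel (by simp) fun k hk => ⟨k ≫ biprod.fst, by
    apply biprod.hom_ext
    · simp
    · simp [hk]⟩

variable [HasExt.{w} C]

/-- The kernel of the composite `M ⟶ A ⟶ A''` is the middle term of the pullback of the extension
along the kernel `A' ⟶ A`. -/
theorem of_kernel_comp_class {p : A ⟶ A''} {u' : A' ⟶ A} (h : IsSES f g) (h' : IsSES u' p) :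
    IsoClass.of (kernel (g ≫ p)) =
      midClass ((Ext.mk₀ u').comp (cls.{w} h) (zero_add 1)) := by
  have := h.epi
  have := h'.epi
  obtain ⟨f', g', h₁, h₂, h₃⟩ := exists_pull h h' (of_kernel (g ≫ p))
  rw [← cls_naturality.{w} h₁ h (𝟙 B) _ u' (by simp [h₂]) h₃, Ext.comp_mk₀_id, midClass_cls]

/-- The quotient of `M` by a subobject `B''` of `B` is the middle term of the pushout of the
extension along `B ⟶ B / B''`. -/
theorem of_cokernel_comp_class {p : B ⟶ B'} {u' : B'' ⟶ B} (h : IsSES f g) (h' : IsSES u' p) :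
    IsoClass.of (cokernel (u' ≫ f)) =
      midClass ((cls.{w} h).comp (Ext.mk₀ p) (add_zero 1)) := by
  have := h.mono
  have := h'.mono
  obtain ⟨f', g', h₁, h₂, h₃⟩ := exists_push h h' (of_cokernel (u' ≫ f))
  rw [cls_naturality.{w} h h₁ p _ (𝟙 A) h₃.symm (by simp [h₂]), Ext.mk₀_id_comp, midClass_cls]

end IsSES

end PullPush

/-! ### The squared norms of the products with a simple class -/

section Gram

variable {C : Type u} [Category.{v} C] [Abelian C]

/-- Two nonzero morphisms to a simple object differ by an automorphism of it, or are jointly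
epimorphic. -/
theorem exists_iso_or_epi_lift {M S : C} [Simple S] {g g' : M ⟶ S} (hg : g ≠ 0) (hg' : g' ≠ 0) :
    (∃ t : S ≅ S, g ≫ t.hom = g') ∨ Epi (biprod.lift g g') := by
  have := epi_of_nonzero_to_simple hg
  by_cases h : kernel.ι g ≫ g' = 0
  · obtain ⟨t, ht⟩ := (IsSES.of_kernel g).exists_desc g' h
    have : IsIso t := isIso_of_hom_simple fun h0 => hg' (by rw [← ht, h0, comp_zero])
    exact .inl ⟨asIso t, ht⟩
  · have := epi_of_nonzero_to_simple h
    refine .inr (Preadditive.epi_of_cancel_zero _ fun c hc => ?_)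
    have h₁ : g ≫ (biprod.inl ≫ c) + g' ≫ (biprod.inr ≫ c) = 0 := by
      rw [← biprod.lift_desc, ← hc]
      congr 1
      apply biprod.hom_ext' <;> simp
    have h₂ : biprod.inr ≫ c = 0 := by
      rw [← cancel_epi (kernel.ι g ≫ g')]
      simpa using congrArg (kernel.ι g ≫ ·) h₁
    rw [h₂, comp_zero, add_zero] at h₁
    have h₃ : biprod.inl ≫ c = 0 := by
      rw [← cancel_epi g, h₁, comp_zero]
    apply biprod.hom_ext' <;> simp [h₂, h₃]

/-- Two nonzero morphisms from a simple object differ by an automorphism of it, or are jointly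
monomorphic. -/
theorem exists_iso_or_mono_desc {M S : C} [Simple S] {f f' : S ⟶ M} (hf : f ≠ 0) (hf' : f' ≠ 0) :
    (∃ t : S ≅ S, t.hom ≫ f = f') ∨ Mono (biprod.desc f f') := by
  have := mono_of_nonzero_from_simple hf
  by_cases h : f' ≫ cokernel.π f = 0
  · obtain ⟨t, ht⟩ := (IsSES.of_cokernel f).exists_lift f' h
    have : IsIso t := isIso_of_hom_simple fun h0 => hf' (by rw [← ht, h0, zero_comp])
    exact .inl ⟨asIso t, ht⟩
  · have := mono_of_nonzero_from_simple h
    refine .inr (Preadditive.mono_of_cancel_zero _ fun c hc => ?_)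
    have h₁ : (c ≫ biprod.fst) ≫ f + (c ≫ biprod.snd) ≫ f' = 0 := by
      rw [← biprod.lift_desc, ← hc]
      congr 1
      apply biprod.hom_ext <;> simp
    have h₂ : c ≫ biprod.snd = 0 := by
      rw [← cancel_mono (f' ≫ cokernel.π f)]
      simpa using congrArg (· ≫ cokernel.π f) h₁
    rw [h₂, zero_comp, add_zero] at h₁
    have h₃ : c ≫ biprod.fst = 0 := by
      rw [← cancel_mono f, h₁, zero_comp]
    apply biprod.hom_ext <;> simp [h₂, h₃]

open Classical in
/-- The value of the function `x` on the kernel of a nonzero morphism. -/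
noncomputable def kerWeight (x : IsoClass C →₀ ℝ) {M A : C} (g : M ⟶ A) : ℝ :=
  if g = 0 then 0 else x (IsoClass.of (kernel g))

open Classical in
/-- The value of the function `x` on the cokernel of a nonzero morphism. -/
noncomputable def cokerWeight (x : IsoClass C →₀ ℝ) {B M : C} (f : B ⟶ M) : ℝ :=
  if f = 0 then 0 else x (IsoClass.of (cokernel f))

section

variable (x : IsoClass C →₀ ℝ)

@[simp]
theorem kerWeight_zero {M A : C} : kerWeight x (0 : M ⟶ A) = 0 := if_pos rfl

@[simp]
theorem cokerWeight_zero {B M : C} : cokerWeight x (0 : B ⟶ M) = 0 := if_pos rfl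

theorem kerWeight_of_ne_zero {M A : C} {g : M ⟶ A} (hg : g ≠ 0) :
    kerWeight x g = x (IsoClass.of (kernel g)) := if_neg hg

theorem cokerWeight_of_ne_zero {B M : C} {f : B ⟶ M} (hf : f ≠ 0) :
    cokerWeight x f = x (IsoClass.of (cokernel f)) := if_neg hf

theorem kerWeight_comp_iso {M A A' : C} (g : M ⟶ A) (t : A ≅ A') :
    kerWeight x (g ≫ t.hom) = kerWeight x g := by
  rcases eq_or_ne g 0 with rfl | hg
  · simp
  rw [kerWeight_of_ne_zero x hg,
    kerWeight_of_ne_zero x fun h => hg ((cancel_mono t.hom).1 (h.trans zero_comp.symm)),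
    IsoClass.of_eq_of (kernelCompMono g t.hom)]

theorem cokerWeight_iso_comp {B' B M : C} (t : B' ≅ B) (f : B ⟶ M) :
    cokerWeight x (t.hom ≫ f) = cokerWeight x f := by
  rcases eq_or_ne f 0 with rfl | hf
  · simp
  rw [cokerWeight_of_ne_zero x hf,
    cokerWeight_of_ne_zero x fun h => hf ((cancel_epi t.hom).1 (h.trans comp_zero.symm)),
    IsoClass.of_eq_of (cokernelEpiComp t.hom f)]

end

variable [∀ X Y : C, Finite (X ⟶ Y)] {S : C} [Simple S]

/-- The pairs of nonzero morphisms to `S` are the proportional pairs, whose kernels coincide, and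
the epimorphisms to `S ⊞ S`. -/
theorem sq_sum_kerWeight (x : IsoClass C →₀ ℝ) (M : C) [DecidablePred fun p : M ⟶ S ⊞ S => Epi p] :
    (∑ g : M ⟶ S, kerWeight x g) ^ 2 =
      Nat.card (S ≅ S) * ∑ g : M ⟶ S, kerWeight x g ^ 2 +
        ∑ p : M ⟶ S ⊞ S,
          if Epi p then kerWeight x (p ≫ biprod.fst) * kerWeight x (p ≫ biprod.snd) else 0 := by
  classical
  have := Fintype.ofFinite (S ≅ S)
  have h₁ : (∑ p : M ⟶ S ⊞ S,
      if Epi p then kerWeight x (p ≫ biprod.fst) * kerWeight x (p ≫ biprod.snd) else 0) =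
      ∑ g : M ⟶ S, ∑ g' : M ⟶ S,
        if Epi (biprod.lift g g') then kerWeight x g * kerWeight x g' else 0 := by
    rw [← Fintype.sum_prod_type' (f := fun g g' : M ⟶ S =>
      if Epi (biprod.lift g g') then kerWeight x g * kerWeight x g' else 0)]
    refine Fintype.sum_equiv ⟨fun p => (p ≫ biprod.fst, p ≫ biprod.snd),
      fun q => biprod.lift q.1 q.2, fun p => ?_, fun q => ?_⟩ _ _ fun p => ?_
    · apply biprod.hom_ext <;> simp
    · simp
    · have : biprod.lift (p ≫ biprod.fst) (p ≫ biprod.snd) = p := by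
        apply biprod.hom_ext <;> simp
      simp [this]
  have h₂ (g : M ⟶ S) : (∑ g' : M ⟶ S, if Epi (biprod.lift g g') then 0 else
      kerWeight x g * kerWeight x g') = Nat.card (S ≅ S) * kerWeight x g ^ 2 := by
    rcases eq_or_ne g 0 with rfl | hg
    · simp
    have hepi := epi_of_nonzero_to_simple hg
    rw [← Fintype.sum_of_injective (fun t : S ≅ S => g ≫ t.hom) (fun s t h => Iso.ext
      ((cancel_epi g).1 h)) (fun _ => kerWeight x g ^ 2)]
    · simp
    · intro g' hg'
      rcases eq_or_ne g' 0 with rfl | h0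
      · simp
      rw [if_pos]
      exact (exists_iso_or_epi_lift hg h0).resolve_left fun ⟨t, ht⟩ => hg' ⟨t, ht⟩
    · intro t
      rw [kerWeight_comp_iso, if_neg, sq]
      intro h
      have h0 : biprod.fst ≫ t.hom - biprod.snd = (0 : S ⊞ S ⟶ S) := by
        rw [← cancel_epi (biprod.lift g (g ≫ t.hom))]
        simp [Preadditive.comp_sub]
      have := congrArg (biprod.inr ≫ ·) h0
      simp [Preadditive.comp_sub, id_nonzero] at this
  rw [h₁, Finset.mul_sum, ← Finset.sum_add_distrib, sq, Finset.sum_mul_sum]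
  refine Finset.sum_congr rfl fun g _ => ?_
  rw [← h₂, ← Finset.sum_add_distrib]
  refine Finset.sum_congr rfl fun g' _ => ?_
  split_ifs <;> simp

end Gram

section Gram

variable {C : Type u} [Category.{v} C] [Abelian C] [∀ X Y : C, Finite (X ⟶ Y)] {S : C} [Simple S]

/-- The dual of `sq_sum_kerWeight`. -/
theorem sq_sum_cokerWeight (x : IsoClass C →₀ ℝ) (M : C)
    [DecidablePred fun p : S ⊞ S ⟶ M => Mono p] :
    (∑ f : S ⟶ M, cokerWeight x f) ^ 2 =
      Nat.card (S ≅ S) * ∑ f : S ⟶ M, cokerWeight x f ^ 2 +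
        ∑ p : S ⊞ S ⟶ M, if Mono p then
          cokerWeight x (biprod.inl ≫ p) * cokerWeight x (biprod.inr ≫ p) else 0 := by
  classical
  have := Fintype.ofFinite (S ≅ S)
  have h₁ : (∑ p : S ⊞ S ⟶ M, if Mono p then
      cokerWeight x (biprod.inl ≫ p) * cokerWeight x (biprod.inr ≫ p) else 0) =
      ∑ f : S ⟶ M, ∑ f' : S ⟶ M,
        if Mono (biprod.desc f f') then cokerWeight x f * cokerWeight x f' else 0 := by
    rw [← Fintype.sum_prod_type' (f := fun f f' : S ⟶ M =>
      if Mono (biprod.desc f f') then cokerWeight x f * cokerWeight x f' else 0)]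
    refine Fintype.sum_equiv ⟨fun p => (biprod.inl ≫ p, biprod.inr ≫ p),
      fun q => biprod.desc q.1 q.2, fun p => ?_, fun q => ?_⟩ _ _ fun p => ?_
    · apply biprod.hom_ext' <;> simp
    · simp
    · have : biprod.desc (biprod.inl ≫ p) (biprod.inr ≫ p) = p := by
        apply biprod.hom_ext' <;> simp
      simp [this]
  have h₂ (f : S ⟶ M) : (∑ f' : S ⟶ M, if Mono (biprod.desc f f') then 0 else
      cokerWeight x f * cokerWeight x f') = Nat.card (S ≅ S) * cokerWeight x f ^ 2 := by
    rcases eq_or_ne f 0 with rfl | hf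
    · simp
    have hmono := mono_of_nonzero_from_simple hf
    rw [← Fintype.sum_of_injective (fun t : S ≅ S => t.hom ≫ f) (fun s t h => Iso.ext
      ((cancel_mono f).1 h)) (fun _ => cokerWeight x f ^ 2)]
    · simp
    · intro f' hf'
      rcases eq_or_ne f' 0 with rfl | h0
      · simp
      rw [if_pos]
      exact (exists_iso_or_mono_desc hf h0).resolve_left fun ⟨t, ht⟩ => hf' ⟨t, ht⟩
    · intro t
      rw [cokerWeight_iso_comp, if_neg, sq]
      intro h
      have h0 : t.hom ≫ biprod.inl - biprod.inr = (0 : S ⟶ S ⊞ S) := by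
        rw [← cancel_mono (biprod.desc f (t.hom ≫ f))]
        simp [Preadditive.sub_comp]
      have := congrArg (· ≫ biprod.snd) h0
      simp [Preadditive.sub_comp, id_nonzero] at this
  rw [h₁, Finset.mul_sum, ← Finset.sum_add_distrib, sq, Finset.sum_mul_sum]
  refine Finset.sum_congr rfl fun f _ => ?_
  rw [← h₂, ← Finset.sum_add_distrib]
  refine Finset.sum_congr rfl fun f' _ => ?_
  split_ifs <;> simp

omit [∀ X Y : C, Finite (X ⟶ Y)] in
theorem ker_class_of_kerWeight_ne_zero {x : IsoClass C →₀ ℝ} {M A : C} {g : M ⟶ A}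
    (h : kerWeight x g ≠ 0) : g ≠ 0 ∧ IsoClass.of (kernel g) ∈ x.support := by
  have hg : g ≠ 0 := by rintro rfl; simp at h
  rw [kerWeight_of_ne_zero x hg] at h
  exact ⟨hg, Finsupp.mem_support_iff.2 h⟩

omit [∀ X Y : C, Finite (X ⟶ Y)] in
theorem coker_class_of_cokerWeight_ne_zero {x : IsoClass C →₀ ℝ} {B M : C} {f : B ⟶ M}
    (h : cokerWeight x f ≠ 0) : f ≠ 0 ∧ IsoClass.of (cokernel f) ∈ x.support := by
  have hf : f ≠ 0 := by rintro rfl; simp at h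
  rw [cokerWeight_of_ne_zero x hf] at h
  exact ⟨hf, Finsupp.mem_support_iff.2 h⟩

omit [∀ X Y : C, Finite (X ⟶ Y)] in
theorem IsSES.g_ne_zero {B M : C} {f : B ⟶ M} {g : M ⟶ S} (h : IsSES f g) : g ≠ 0 := by
  rintro rfl
  have := h.epi
  exact id_nonzero S ((cancel_epi (0 : M ⟶ S)).1 (by simp))

omit [∀ X Y : C, Finite (X ⟶ Y)] in
theorem IsSES.f_ne_zero {M A : C} {f : S ⟶ M} {g : M ⟶ A} (h : IsSES f g) : f ≠ 0 := by
  rintro rfl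
  have := h.mono
  exact id_nonzero S ((cancel_mono (0 : S ⟶ M)).1 (by simp))

omit [∀ X Y : C, Finite (X ⟶ Y)] in
theorem kerWeight_g {x : IsoClass C →₀ ℝ} {B M : C} {f : B ⟶ M} {g : M ⟶ S} (h : IsSES f g) :
    kerWeight x g = x (IsoClass.of B) := by
  rw [kerWeight_of_ne_zero x h.g_ne_zero, h.of_kernel_class]

omit [∀ X Y : C, Finite (X ⟶ Y)] in
theorem cokerWeight_f {x : IsoClass C →₀ ℝ} {M A : C} {f : S ⟶ M} {g : M ⟶ A} (h : IsSES f g) :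
    cokerWeight x f = x (IsoClass.of A) := by
  rw [cokerWeight_of_ne_zero x h.f_ne_zero, h.of_cokernel_class]

variable [HasExt.{w} C] [∀ X Y : C, Finite (Ext.{w} X Y 1)]

/-- The squared norm of `u_S x`, up to normalization, when the values of `x` at the extensions of
`S` by any object add up to zero.  The epimorphisms to `S ⊞ S` contribute nothing: the pairs of
their kernels are sums over pairs of classes in `Ext¹(S, K)`, which are products of vanishing sums.
-/ theorem sum_sq_kerWeight (x : IsoClass C →₀ ℝ) (T : Finset (IsoClass C))
    (hT : ∀ X ∈ x.support, ∀ e : Ext.{w} S X.rep 1, midClass e ∈ T)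
    (hx : ∀ B : C, ∑ e : Ext.{w} S B 1, x (midClass e) = 0) :
    ∑ M ∈ T, (autCard M : ℝ)⁻¹ * (∑ g : M.rep ⟶ S, kerWeight x g) ^ 2 =
      Nat.card (S ≅ S) * ∑ X ∈ x.support, (autCard X : ℝ)⁻¹ *
        ((Nat.card (S ⟶ X.rep) : ℝ)⁻¹ * (Nat.card (Ext.{w} S X.rep 1) * x X ^ 2)) := by
  classical
  have h₁ : ∑ M ∈ T, (autCard M : ℝ)⁻¹ * ∑ g : M.rep ⟶ S, kerWeight x g ^ 2 =
      ∑ X ∈ x.support, (autCard X : ℝ)⁻¹ *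
        ((Nat.card (S ⟶ X.rep) : ℝ)⁻¹ * (Nat.card (Ext.{w} S X.rep 1) * x X ^ 2)) := by
    rw [sum_sum_epi_eq (A := S) T x.support (fun M g => kerWeight x g ^ 2)
      (fun X (_ : Ext.{w} S X.rep 1) => x X ^ 2)]
    · simp
    · intro M g hg
      obtain ⟨h, h'⟩ := ker_class_of_kerWeight_ne_zero (pow_ne_zero_iff two_ne_zero |>.1 hg)
      exact ⟨epi_of_nonzero_to_simple h, h'⟩
    · intro X M y
      rw [kerWeight_g y.isSES, IsoClass.of_rep]
    · exact fun X hX e _ => hT X hX e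
  -- the classes of the kernels of epimorphisms onto `S ⊞ S` that contribute
  let D : Finset (IsoClass C) := x.support.biUnion fun X =>
    Finset.univ.image fun g : X.rep ⟶ S => IsoClass.of (kernel g)
  have h₂ : ∑ M ∈ T, (autCard M : ℝ)⁻¹ * ∑ p : M.rep ⟶ S ⊞ S, (if Epi p then
      kerWeight x (p ≫ biprod.fst) * kerWeight x (p ≫ biprod.snd) else 0) = 0 := by
    rw [sum_sum_epi_eq (A := S ⊞ S) T D (fun M p => if Epi p then
        kerWeight x (p ≫ biprod.fst) * kerWeight x (p ≫ biprod.snd) else 0)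
      (fun X (e : Ext.{w} (S ⊞ S) X.rep 1) =>
        x (midClass ((Ext.mk₀ biprod.inr).comp e (zero_add 1))) *
          x (midClass ((Ext.mk₀ biprod.inl).comp e (zero_add 1))))]
    · refine Finset.sum_eq_zero fun X _ => ?_
      have h : ∑ e : Ext.{w} (S ⊞ S) X.rep 1,
          x (midClass ((Ext.mk₀ biprod.inr).comp e (zero_add 1))) *
            x (midClass ((Ext.mk₀ biprod.inl).comp e (zero_add 1))) =
          ∑ q : Ext.{w} S X.rep 1 × Ext.{w} S X.rep 1, x (midClass q.2) * x (midClass q.1) :=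
        Fintype.sum_equiv Ext.biprodAddEquiv.toEquiv _ _ fun e => rfl
      rw [h, Fintype.sum_prod_type]
      simp [← Finset.sum_mul, hx]
    · intro M p hp
      have hepi : Epi p := by by_contra h; simp [h] at hp
      refine ⟨hepi, ?_⟩
      rw [if_pos hepi] at hp
      obtain ⟨h, h'⟩ := ker_class_of_kerWeight_ne_zero (left_ne_zero_of_mul hp)
      obtain ⟨i⟩ := IsoClass.nonempty_rep_iso (kernel (p ≫ biprod.fst))
      obtain ⟨f', g', h₁, h₂, h₃⟩ := (IsSES.of_kernel p).exists_pull (IsSES.biprod_inr_fst S S)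
        (IsSES.of_kernel (p ≫ biprod.fst))
      refine Finset.mem_biUnion.2 ⟨_, h', Finset.mem_image.2 ⟨i.hom ≫ g', Finset.mem_univ _, ?_⟩⟩
      have h₄ : IsSES (f' ≫ i.inv) (i.hom ≫ g') :=
        h₁.of_iso (Iso.refl _) i.symm (Iso.refl _) (by simp) (by simp)
      exact h₄.of_kernel_class
    · intro X M y
      have := y.isSES.epi
      have e₁ : y.g ≫ biprod.fst ≠ 0 := (IsSES.of_kernel _).g_ne_zero
      have e₂ : y.g ≫ biprod.snd ≠ 0 := (IsSES.of_kernel _).g_ne_zero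
      rw [if_pos this, kerWeight_of_ne_zero x e₁, kerWeight_of_ne_zero x e₂,
        IsSES.of_kernel_comp_class.{w} y.isSES (IsSES.biprod_inr_fst S S),
        IsSES.of_kernel_comp_class.{w} y.isSES (IsSES.biprod_inl_snd S S)]
      rfl
    · intro X _ e he
      have hm := Finsupp.mem_support_iff.2 (left_ne_zero_of_mul he)
      obtain ⟨y, hy⟩ := exists_extension e
      have := y.isSES.epi
      rw [← hy, show y.cls = y.isSES.cls from rfl,
        ← IsSES.of_kernel_comp_class.{w} y.isSES (IsSES.biprod_inr_fst S S)] at hm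
      have hk := IsSES.of_kernel (y.g ≫ biprod.fst)
      obtain ⟨i⟩ := IsoClass.nonempty_rep_iso (kernel (y.g ≫ biprod.fst))
      have hk' : IsSES (i.hom ≫ kernel.ι _) (y.g ≫ biprod.fst) :=
        hk.of_iso i.symm (Iso.refl _) (Iso.refl _) (by simp) (by simp)
      have := hT _ hm hk'.cls
      rwa [midClass_cls, IsoClass.of_rep] at this
  simp_rw [sq_sum_kerWeight, mul_add, Finset.sum_add_distrib]
  rw [h₂, add_zero, ← h₁, Finset.mul_sum]
  exact Finset.sum_congr rfl fun M _ => mul_left_comm _ _ _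

/-- The squared norm of `x u_S`, up to normalization: the dual of `sum_sq_kerWeight`. -/
theorem sum_sq_cokerWeight (x : IsoClass C →₀ ℝ) (T : Finset (IsoClass C))
    (hT : ∀ X ∈ x.support, ∀ e : Ext.{w} X.rep S 1, midClass e ∈ T)
    (hx : ∀ A : C, ∑ e : Ext.{w} A S 1, x (midClass e) = 0) :
    ∑ M ∈ T, (autCard M : ℝ)⁻¹ * (∑ f : S ⟶ M.rep, cokerWeight x f) ^ 2 =
      Nat.card (S ≅ S) * ∑ X ∈ x.support, (autCard X : ℝ)⁻¹ *
        ((Nat.card (X.rep ⟶ S) : ℝ)⁻¹ * (Nat.card (Ext.{w} X.rep S 1) * x X ^ 2)) := by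
  classical
  have h₁ : ∑ M ∈ T, (autCard M : ℝ)⁻¹ * ∑ f : S ⟶ M.rep, cokerWeight x f ^ 2 =
      ∑ X ∈ x.support, (autCard X : ℝ)⁻¹ *
        ((Nat.card (X.rep ⟶ S) : ℝ)⁻¹ * (Nat.card (Ext.{w} X.rep S 1) * x X ^ 2)) := by
    rw [sum_sum_mono_eq (B := S) T x.support (fun M f => cokerWeight x f ^ 2)
      (fun X (_ : Ext.{w} X.rep S 1) => x X ^ 2)]
    · simp
    · intro M f hf
      obtain ⟨h, h'⟩ := coker_class_of_cokerWeight_ne_zero (pow_ne_zero_iff two_ne_zero |>.1 hf)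
      exact ⟨mono_of_nonzero_from_simple h, h'⟩
    · intro X M y
      rw [cokerWeight_f y.isSES, IsoClass.of_rep]
    · exact fun X hX e _ => hT X hX e
  -- the classes of the cokernels of monomorphisms from `S ⊞ S` that contribute
  let D : Finset (IsoClass C) := x.support.biUnion fun X =>
    Finset.univ.image fun f : S ⟶ X.rep => IsoClass.of (cokernel f)
  have h₂ : ∑ M ∈ T, (autCard M : ℝ)⁻¹ * ∑ p : S ⊞ S ⟶ M.rep, (if Mono p then
      cokerWeight x (biprod.inl ≫ p) * cokerWeight x (biprod.inr ≫ p) else 0) = 0 := by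
    rw [sum_sum_mono_eq (B := S ⊞ S) T D (fun M p => if Mono p then
        cokerWeight x (biprod.inl ≫ p) * cokerWeight x (biprod.inr ≫ p) else 0)
      (fun X (e : Ext.{w} X.rep (S ⊞ S) 1) =>
        x (midClass (e.comp (Ext.mk₀ biprod.snd) (add_zero 1))) *
          x (midClass (e.comp (Ext.mk₀ biprod.fst) (add_zero 1))))]
    · refine Finset.sum_eq_zero fun X _ => ?_
      have h : ∑ e : Ext.{w} X.rep (S ⊞ S) 1,
          x (midClass (e.comp (Ext.mk₀ biprod.snd) (add_zero 1))) *
            x (midClass (e.comp (Ext.mk₀ biprod.fst) (add_zero 1))) =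
          ∑ q : Ext.{w} X.rep S 1 × Ext.{w} X.rep S 1, x (midClass q.2) * x (midClass q.1) :=
        Fintype.sum_equiv Ext.addEquivBiprod.toEquiv _ _ fun e => rfl
      rw [h, Fintype.sum_prod_type]
      simp [← Finset.sum_mul, hx]
    · intro M p hp
      have hmono : Mono p := by by_contra h; simp [h] at hp
      refine ⟨hmono, ?_⟩
      rw [if_pos hmono] at hp
      obtain ⟨h, h'⟩ := coker_class_of_cokerWeight_ne_zero (left_ne_zero_of_mul hp)
      obtain ⟨i⟩ := IsoClass.nonempty_rep_iso (cokernel (biprod.inl ≫ p))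
      obtain ⟨f', g', h₁, h₂, h₃⟩ := (IsSES.of_cokernel p).exists_push (IsSES.biprod_inl_snd S S)
        (IsSES.of_cokernel (biprod.inl ≫ p))
      refine Finset.mem_biUnion.2 ⟨_, h', Finset.mem_image.2 ⟨f' ≫ i.inv, Finset.mem_univ _, ?_⟩⟩
      have h₄ : IsSES (f' ≫ i.inv) (i.hom ≫ g') :=
        h₁.of_iso (Iso.refl _) i.symm (Iso.refl _) (by simp) (by simp)
      exact h₄.of_cokernel_class
    · intro X M y
      have := y.isSES.mono
      have e₁ : biprod.inl ≫ y.f ≠ 0 := (IsSES.of_cokernel _).f_ne_zero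
      have e₂ : biprod.inr ≫ y.f ≠ 0 := (IsSES.of_cokernel _).f_ne_zero
      rw [if_pos this, cokerWeight_of_ne_zero x e₁, cokerWeight_of_ne_zero x e₂,
        IsSES.of_cokernel_comp_class.{w} y.isSES (IsSES.biprod_inl_snd S S),
        IsSES.of_cokernel_comp_class.{w} y.isSES (IsSES.biprod_inr_fst S S)]
      rfl
    · intro X _ e he
      have hm := Finsupp.mem_support_iff.2 (left_ne_zero_of_mul he)
      obtain ⟨y, hy⟩ := exists_extension e
      have := y.isSES.mono
      rw [← hy, show y.cls = y.isSES.cls from rfl,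
        ← IsSES.of_cokernel_comp_class.{w} y.isSES (IsSES.biprod_inl_snd S S)] at hm
      have hk := IsSES.of_cokernel (biprod.inl ≫ y.f)
      obtain ⟨i⟩ := IsoClass.nonempty_rep_iso (cokernel (biprod.inl ≫ y.f))
      have hk' : IsSES (biprod.inl ≫ y.f) (cokernel.π _ ≫ i.inv) :=
        hk.of_iso (Iso.refl _) (Iso.refl _) i.symm (by simp) (by simp)
      have := hT _ hm hk'.cls
      rwa [midClass_cls, IsoClass.of_rep] at this
  simp_rw [sq_sum_cokerWeight, mul_add, Finset.sum_add_distrib]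
  rw [h₂, add_zero, ← h₁, Finset.mul_sum]
  exact Finset.sum_congr rfl fun M _ => mul_left_comm _ _ _

end Gram

/-! ### The inner product of `u_S x` and `x u_S` -/

theorem AddMonoidHom.sum_comp_eq_zero_of_surjective {G H : Type*} [AddCommGroup G] [AddCommGroup H]
    [Fintype G] [Fintype H] (φ : G →+ H) (hφ : Function.Surjective φ) {F : H → ℝ}
    (hF : ∑ h, F h = 0) : ∑ g, F (φ g) = 0 := by
  classical
  rw [← Fintype.sum_fiberwise φ]
  have h (b : H) : ∑ a : {a // φ a = b}, F (φ a) = Nat.card φ.ker * F b := by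
    obtain ⟨c, rfl⟩ := hφ b
    rw [Finset.sum_congr rfl (g := fun _ => F (φ c)) (by rintro ⟨a, ha⟩ -; simp only [ha]),
      Finset.sum_const, Finset.card_univ, nsmul_eq_mul, ← Nat.card_eq_fintype_card]
    congr 2
    exact Nat.card_congr ⟨fun a => ⟨a.1 - c, by simp [AddMonoidHom.mem_ker, a.2]⟩,
      fun a => ⟨a.1 + c, by simp [AddMonoidHom.mem_ker.1 a.2]⟩, fun a => by simp,
      fun a => by simp⟩
  simp_rw [h, ← Finset.mul_sum, hF, mul_zero]

section Gram

variable {C : Type u} [Category.{v} C] [Abelian C] {S : C}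

/-- A morphism from a simple object to `M` that is invertible modulo `X` is a complement
of `X`. -/
theorem IsSES.coker_class_of_isIso {X M A : C} {f : X ⟶ M} {g : M ⟶ A} (h : IsSES f g) (s : S ⟶ M)
    [IsIso (s ≫ g)] : IsoClass.of (cokernel s) = IsoClass.of X := by
  have := h.mono
  have := h.epi
  have hm : Mono s := mono_of_mono s g
  have : Mono (f ≫ cokernel.π s) := by
    refine Preadditive.mono_of_cancel_zero _ fun k hk => ?_
    obtain ⟨l, hl⟩ := (IsSES.of_cokernel s).exists_lift (k ≫ f) (by simpa using hk)
    have : l = 0 := by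
      rw [← cancel_mono (s ≫ g), ← Category.assoc, hl, Category.assoc, h.zero, comp_zero, zero_comp]
    rw [← cancel_mono f, ← hl, this, zero_comp, zero_comp]
  have : Epi (f ≫ cokernel.π s) := by
    refine Preadditive.epi_of_cancel_zero _ fun c hc => ?_
    obtain ⟨d, hd⟩ := h.exists_desc (cokernel.π s ≫ c) (by simpa using hc)
    have : d = 0 := by
      rw [← cancel_epi (s ≫ g), Category.assoc, hd, cokernel.condition_assoc, zero_comp, comp_zero]
    rw [← cancel_epi (cokernel.π s), ← hd, this, comp_zero, comp_zero]
  have := isIso_of_mono_of_epi (f ≫ cokernel.π s)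
  exact (IsoClass.of_eq_of (asIso (f ≫ cokernel.π s))).symm

variable [Simple S] [∀ X Y : C, Finite (X ⟶ Y)] [HasExt.{w} C] [∀ X Y : C, Finite (Ext.{w} X Y 1)]

/-- The simple subobjects of the extensions of `S` by `X`.  Those inside `X` contribute a sum over
the extensions of `S` by a quotient of `X`, which vanishes; the others split the extension. -/
theorem sum_ext_sum_cokerWeight (x : IsoClass C →₀ ℝ)
    (hx : ∀ B : C, ∑ e : Ext.{w} S B 1, x (midClass e) = 0)
    (hS : ∀ {X Y : C} (p : X ⟶ Y) [Epi p] (e : Ext.{w} S Y 1),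
      ∃ e' : Ext.{w} S X 1, e'.comp (Ext.mk₀ p) (add_zero 1) = e) (X : C) :
    ∑ e : Ext.{w} S X 1, ∑ f : S ⟶ (midClass e).rep, cokerWeight x f =
      Nat.card (S ≅ S) * (Nat.card (S ⟶ X) * x (IsoClass.of X)) := by
  classical
  have := Fintype.ofFinite (S ≅ S)
  choose y hy using fun e : Ext.{w} S X 1 => exists_extension e
  -- the simple subobjects inside `X`, as monomorphisms `t : S ⟶ X`
  have h₁ (e : Ext.{w} S X 1) : (∑ f : S ⟶ (midClass e).rep,
      if f ≫ (y e).g = 0 then cokerWeight x f else 0) =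
      ∑ t : S ⟶ X, if t = 0 then 0 else
        x (midClass (e.comp (Ext.mk₀ (cokernel.π t)) (add_zero 1))) := by
    have hm := (y e).isSES.mono
    symm
    refine Fintype.sum_of_injective (fun t => t ≫ (y e).f) (fun s t h => (cancel_mono _).1 h) _ _
      (fun f hf => if_neg fun h0 => hf ((y e).isSES.exists_lift f h0)) fun t => ?_
    rcases eq_or_ne t 0 with h0 | h0
    · simp [h0]
    have := mono_of_nonzero_from_simple h0
    rw [if_neg h0, if_pos (by rw [Category.assoc, (y e).isSES.zero, comp_zero]),
      cokerWeight_of_ne_zero x fun h => h0 ((cancel_mono (y e).f).1 (h.trans zero_comp.symm)),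
      IsSES.of_cokernel_comp_class.{w} (y e).isSES (IsSES.of_cokernel t)]
    rw [show (y e).isSES.cls = e from hy e]
  have h₂ : (∑ e : Ext.{w} S X 1, ∑ t : S ⟶ X, if t = 0 then 0 else
      x (midClass (e.comp (Ext.mk₀ (cokernel.π t)) (add_zero 1)))) = 0 := by
    rw [Finset.sum_comm]
    refine Finset.sum_eq_zero fun t _ => ?_
    split_ifs
    · simp
    · exact AddMonoidHom.sum_comp_eq_zero_of_surjective
        ((Ext.mk₀ (cokernel.π t)).postcomp S (add_zero 1)) (hS (cokernel.π t))
        (F := fun e => x (midClass e)) (hx _)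
  -- only the split extension has simple subobjects that are complements of `X`
  have h₃ (e : Ext.{w} S X 1) (he : e ≠ 0) : (∑ f : S ⟶ (midClass e).rep,
      if f ≫ (y e).g = 0 then 0 else cokerWeight x f) = 0 := by
    refine Finset.sum_eq_zero fun f _ => if_pos ?_
    by_contra h0
    have := isIso_of_hom_simple h0
    apply he
    have h4 : (Ext.mk₀ (y e).g).comp e (zero_add 1) = 0 := by
      have := (y e).isSES.2.comp_extClass
      rwa [show (y e).isSES.2.extClass = e from hy e] at this
    rw [← Ext.mk₀_id_comp e, ← IsIso.inv_hom_id (f ≫ (y e).g), ← Category.assoc,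
      ← Ext.mk₀_comp_mk₀_assoc, h4, Ext.comp_zero]
  -- the morphisms `S ⟶ S ⊞ X` with invertible first component
  have h₄ : (∑ f : S ⟶ (midClass (0 : Ext.{w} S X 1)).rep,
      if f ≫ (y 0).g = 0 then 0 else cokerWeight x f) =
      Nat.card (S ≅ S) * (Nat.card (S ⟶ X) * x (IsoClass.of X)) := by
    have hm := (y 0).isSES.mono
    obtain ⟨s, hs⟩ : ∃ s, s ≫ (y 0).g = 𝟙 S := by
      obtain ⟨s, hs⟩ := Ext.covariant_sequence_exact₃ S (y 0).isSES.2 (Ext.mk₀ (𝟙 S)) (n₁ := 1) rfl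
        (by rw [show (y 0).isSES.2.extClass = 0 from hy 0, Ext.comp_zero])
      obtain ⟨s, rfl⟩ := (Ext.mk₀_bijective _ _).2 s
      exact ⟨s, (Ext.mk₀_bijective _ _).1 (by rw [← hs, Ext.mk₀_comp_mk₀])⟩
    have hc (t : S ≅ S) (k : S ⟶ X) : (t.hom ≫ s + k ≫ (y 0).f) ≫ (y 0).g = t.hom := by
      rw [Preadditive.add_comp, Category.assoc, Category.assoc, hs, (y 0).isSES.zero]
      simp
    rw [← Fintype.sum_of_injective
      (fun q : (S ≅ S) × (S ⟶ X) => q.1.hom ≫ s + q.2 ≫ (y 0).f) (fun q q' h => ?_)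
      (fun _ => x (IsoClass.of X)) _ (fun f hf => ?_) fun q => ?_]
    · simp [mul_assoc]
    · have h5 : q.1 = q'.1 :=
        Iso.ext (by rw [← hc q.1 q.2, ← hc q'.1 q'.2]; exact congrArg (· ≫ _) h)
      refine Prod.ext h5 ?_
      simpa [h5, cancel_mono] using h
    · refine if_pos (by_contra fun h0 => hf ?_)
      have := isIso_of_hom_simple h0
      obtain ⟨k, hk⟩ := (y 0).isSES.exists_lift (f - (f ≫ (y 0).g) ≫ s) (by
        rw [Preadditive.sub_comp, Category.assoc, hs, Category.comp_id, sub_self])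
      exact ⟨(asIso (f ≫ (y 0).g), k), by simp [hk]⟩
    · have h0 : q.1.hom ≠ 0 := fun h => id_nonzero S (by rw [← q.1.hom_inv_id, h, zero_comp])
      have hi : IsIso ((q.1.hom ≫ s + q.2 ≫ (y 0).f) ≫ (y 0).g) := by
        rw [hc]; infer_instance
      rw [hc, if_neg h0, cokerWeight_of_ne_zero x fun h => h0 (by rw [← hc q.1 q.2, h, zero_comp]),
        IsSES.coker_class_of_isIso (y 0).isSES]
  have h₅ (e : Ext.{w} S X 1) : ∑ f : S ⟶ (midClass e).rep, cokerWeight x f =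
      (∑ f : S ⟶ (midClass e).rep, if f ≫ (y e).g = 0 then cokerWeight x f else 0) +
      ∑ f : S ⟶ (midClass e).rep, if f ≫ (y e).g = 0 then 0 else cokerWeight x f := by
    rw [← Finset.sum_add_distrib]
    refine Finset.sum_congr rfl fun f _ => ?_
    split_ifs <;> simp
  simp_rw [h₅, Finset.sum_add_distrib, h₁]
  rw [h₂, zero_add, Finset.sum_eq_single 0 (fun e _ he => h₃ e he) (by simp), h₄]

/-- The inner product of `u_S x` and `x u_S`, up to normalization. -/
theorem sum_kerWeight_mul_cokerWeight (x : IsoClass C →₀ ℝ) (T : Finset (IsoClass C))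
    (hT : ∀ X ∈ x.support, ∀ e : Ext.{w} S X.rep 1, midClass e ∈ T)
    (hx : ∀ B : C, ∑ e : Ext.{w} S B 1, x (midClass e) = 0)
    (hS : ∀ {X Y : C} (p : X ⟶ Y) [Epi p] (e : Ext.{w} S Y 1),
      ∃ e' : Ext.{w} S X 1, e'.comp (Ext.mk₀ p) (add_zero 1) = e) :
    ∑ M ∈ T, (autCard M : ℝ)⁻¹ *
        ((∑ g : M.rep ⟶ S, kerWeight x g) * ∑ f : S ⟶ M.rep, cokerWeight x f) =
      Nat.card (S ≅ S) * ∑ X ∈ x.support, (autCard X : ℝ)⁻¹ * x X ^ 2 := by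
  simp_rw [Finset.sum_mul]
  rw [sum_sum_epi_eq (A := S) T x.support
    (fun M g => kerWeight x g * ∑ f : S ⟶ M.rep, cokerWeight x f)
    (fun X (e : Ext.{w} S X.rep 1) => x X * ∑ f : S ⟶ (midClass e).rep, cokerWeight x f)]
  · rw [Finset.mul_sum]
    refine Finset.sum_congr rfl fun X _ => ?_
    have : (Nat.card (S ⟶ X.rep) : ℝ) ≠ 0 := Nat.cast_ne_zero.2 Nat.card_pos.ne'
    rw [← Finset.mul_sum, sum_ext_sum_cokerWeight x hx hS, IsoClass.of_rep]
    field_simp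
  · intro M g hg
    obtain ⟨h, h'⟩ := ker_class_of_kerWeight_ne_zero (left_ne_zero_of_mul hg)
    exact ⟨epi_of_nonzero_to_simple h, h'⟩
  · intro X M y
    have hM : midClass (y.cls) = M := (midClass_cls.{w} y.isSES).trans (IsoClass.of_rep M)
    rw [kerWeight_g y.isSES, IsoClass.of_rep, hM]
  · exact fun X hX e _ => hT X hX e

/-- The Cauchy-Schwarz inequality for `u_S x` and `x u_S`, where `x` is orthogonal to the products.
Here `a` and `b` stand for `q ^ (-⟨S, θ⟩)` and `q ^ (-⟨θ, S⟩)`, where `θ` is the degree of `x`. -/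
theorem one_le_mul_of_primitive (x : IsoClass C →₀ ℝ) (hx0 : x ≠ 0) {a b : ℝ}
    (ha : ∀ X ∈ x.support, (Nat.card (Ext.{w} S X.rep 1) : ℝ) = a * Nat.card (S ⟶ X.rep))
    (hb : ∀ X ∈ x.support, (Nat.card (Ext.{w} X.rep S 1) : ℝ) = b * Nat.card (X.rep ⟶ S))
    (hx : ∀ B : C, ∑ e : Ext.{w} S B 1, x (midClass e) = 0)
    (hx' : ∀ A : C, ∑ e : Ext.{w} A S 1, x (midClass e) = 0)
    (hS : ∀ {X Y : C} (p : X ⟶ Y) [Epi p] (e : Ext.{w} S Y 1),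
      ∃ e' : Ext.{w} S X 1, e'.comp (Ext.mk₀ p) (add_zero 1) = e) : 1 ≤ a * b := by
  classical
  let T : Finset (IsoClass C) := x.support.biUnion fun X =>
    (Finset.univ.image fun e : Ext.{w} S X.rep 1 => midClass e) ∪
      Finset.univ.image fun e : Ext.{w} X.rep S 1 => midClass e
  have hT : ∀ X ∈ x.support, ∀ e : Ext.{w} S X.rep 1, midClass e ∈ T := fun X hX e =>
    Finset.mem_biUnion.2 ⟨X, hX, Finset.mem_union_left _ (Finset.mem_image_of_mem _ (by simp))⟩
  have hT' : ∀ X ∈ x.support, ∀ e : Ext.{w} X.rep S 1, midClass e ∈ T := fun X hX e =>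
    Finset.mem_biUnion.2 ⟨X, hX, Finset.mem_union_right _ (Finset.mem_image_of_mem _ (by simp))⟩
  set P : ℝ := ∑ X ∈ x.support, (autCard X : ℝ)⁻¹ * x X ^ 2 with hP
  have hPpos : 0 < P := Finset.sum_pos (fun X hX => by
    have := autCard_pos X
    have := Finsupp.mem_support_iff.1 hX
    positivity) (Finsupp.support_nonempty_iff.2 hx0)
  have hapos : 0 < (Nat.card (S ≅ S) : ℝ) := by
    have : Nonempty (S ≅ S) := ⟨Iso.refl _⟩
    exact_mod_cast Nat.card_pos
  obtain ⟨X₀, hX₀⟩ := Finsupp.support_nonempty_iff.2 hx0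
  have hbpos : 0 < b := by
    have h1 : (0 : ℝ) < Nat.card (Ext.{w} X₀.rep S 1) := by exact_mod_cast Nat.card_pos
    rw [hb X₀ hX₀] at h1
    exact pos_of_mul_pos_left h1 (Nat.cast_nonneg _)
  have hA := sum_sq_kerWeight.{w} x T hT hx
  have hB := sum_sq_cokerWeight.{w} x T hT' hx'
  have hC := sum_kerWeight_mul_cokerWeight.{w} x T hT hx hS
  have hA' : ∑ X ∈ x.support, (autCard X : ℝ)⁻¹ *
      ((Nat.card (S ⟶ X.rep) : ℝ)⁻¹ * (Nat.card (Ext.{w} S X.rep 1) * x X ^ 2)) = a * P := by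
    rw [hP, Finset.mul_sum]
    refine Finset.sum_congr rfl fun X hX => ?_
    have : (Nat.card (S ⟶ X.rep) : ℝ) ≠ 0 := Nat.cast_ne_zero.2 Nat.card_pos.ne'
    rw [ha X hX]
    field_simp
  have hB' : ∑ X ∈ x.support, (autCard X : ℝ)⁻¹ *
      ((Nat.card (X.rep ⟶ S) : ℝ)⁻¹ * (Nat.card (Ext.{w} X.rep S 1) * x X ^ 2)) = b * P := by
    rw [hP, Finset.mul_sum]
    refine Finset.sum_congr rfl fun X hX => ?_
    have : (Nat.card (X.rep ⟶ S) : ℝ) ≠ 0 := Nat.cast_ne_zero.2 Nat.card_pos.ne'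
    rw [hb X hX]
    field_simp
  rw [hA'] at hA
  rw [hB'] at hB
  rw [← hP] at hC
  -- up to a common factor, the Gram matrix of `u_S x` and `x u_S` has the diagonal entries `a`, `b`
  -- and the off-diagonal entry `1`, so that `(b, -1)` is an isotropic vector when `a * b = 1`
  have key : 0 ≤ ∑ M ∈ T, (autCard M : ℝ)⁻¹ *
      (b * (∑ g : M.rep ⟶ S, kerWeight x g) - ∑ f : S ⟶ M.rep, cokerWeight x f) ^ 2 :=
    Finset.sum_nonneg fun M _ => by positivity
  have expand : ∑ M ∈ T, (autCard M : ℝ)⁻¹ *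
      (b * (∑ g : M.rep ⟶ S, kerWeight x g) - ∑ f : S ⟶ M.rep, cokerWeight x f) ^ 2 =
      b ^ 2 * (Nat.card (S ≅ S) * (a * P)) - 2 * b * (Nat.card (S ≅ S) * P) +
        Nat.card (S ≅ S) * (b * P) := by
    rw [← hA, ← hB, ← hC, Finset.mul_sum, Finset.mul_sum, ← Finset.sum_sub_distrib,
      ← Finset.sum_add_distrib]
    exact Finset.sum_congr rfl fun M _ => by ring
  rw [expand] at key
  have h2 : 0 ≤ (b * Nat.card (S ≅ S) * P) * (a * b - 1) := by linarith
  linarith [nonneg_of_mul_nonneg_right h2 (by positivity)]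

end Gram

/-! ### Dimension vectors -/

section DimVec

variable {C : Type u} [Category.{v} C] [Abelian C]

instance simple_rep (i : SimpleClass C) : Simple i.1.rep := i.2

theorem SimpleClass.eq_of_iso {i j : SimpleClass C} (e : i.1.rep ≅ j.1.rep) : i = j := by
  refine Subtype.ext ?_
  rw [← IsoClass.of_rep i.1, ← IsoClass.of_rep j.1]
  exact IsoClass.of_eq_of e

theorem HasDimVec.of_isSES_simple {X Y : C} {i : SimpleClass C} {f : Y ⟶ X} {g : X ⟶ i.1.rep}
    (h : IsSES f g) {d : SimpleClass C →₀ ℕ} (hY : HasDimVec Y d) :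
    HasDimVec X (d + Finsupp.single i 1) := by
  have := h.mono
  obtain ⟨t, -⟩ := (IsSES.of_cokernel f).exists_iso_right h
  exact .extend f h.mono i ⟨t⟩ d hY

theorem HasDimVec.exists_isSES {X : C} {d : SimpleClass C →₀ ℕ} (h : HasDimVec X d) :
    (IsZero X ∧ d = 0) ∨ ∃ (Y : C) (i : SimpleClass C) (f : Y ⟶ X) (g : X ⟶ i.1.rep)
      (d' : SimpleClass C →₀ ℕ), IsSES f g ∧ HasDimVec Y d' ∧ d = d' + Finsupp.single i 1 := by
  cases h with
  | zero hX => exact .inl ⟨hX, rfl⟩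
  | extend f hf i hi d' hY =>
    obtain ⟨t⟩ := hi
    exact .inr ⟨_, i, f, cokernel.π f ≫ t.hom, d', (IsSES.of_cokernel f).of_iso (Iso.refl _)
      (Iso.refl _) t (by simp) (by simp), hY, rfl⟩

theorem HasDimVec.of_iso {X X' : C} {d : SimpleClass C →₀ ℕ} (h : HasDimVec X d) (e : X ≅ X') :
    HasDimVec X' d := by
  obtain ⟨hX, rfl⟩ | ⟨Y, i, f, g, d', hs, hY, rfl⟩ := h.exists_isSES
  · exact .zero (hX.of_iso e.symm)
  · exact .of_isSES_simple (hs.of_iso (f' := f ≫ e.hom) (g' := e.inv ≫ g) (Iso.refl _) e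
      (Iso.refl _) (by simp) (by simp)) hY

theorem HasDimVec.isZero {X : C} (h : HasDimVec X 0) : IsZero X := by
  obtain ⟨hX, -⟩ | ⟨Y, i, f, g, d', hs, hY, hd⟩ := h.exists_isSES
  · exact hX
  · have := DFunLike.congr_fun hd i
    simp at this

open ZeroObject in
theorem HasDimVec.simple (i : SimpleClass C) : HasDimVec i.1.rep (Finsupp.single i 1) := by
  have : IsSES (0 : (0 : C) ⟶ i.1.rep) (𝟙 i.1.rep) :=
    IsSES.of_isKernel (by simp) fun k hk => ⟨0, by simpa using hk.symm⟩
  simpa using HasDimVec.of_isSES_simple this (.zero (isZero_zero C))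

/-- Dimension vectors are additive in short exact sequences. -/
theorem HasDimVec.add {A B M : C} {f : B ⟶ M} {g : M ⟶ A} {μ ν : SimpleClass C →₀ ℕ}
    (hA : HasDimVec A μ) (hB : HasDimVec B ν) (h : IsSES f g) : HasDimVec M (μ + ν) := by
  induction hA generalizing M with
  | zero hA =>
    have := h.mono
    have : Epi f := Preadditive.epi_of_cancel_zero _ fun c hc => by
      obtain ⟨l, rfl⟩ := h.exists_desc c hc
      rw [hA.eq_of_src l 0, comp_zero]
    have := isIso_of_mono_of_epi f
    simpa using hB.of_iso (asIso f)
  | extend u' hu i hi d _ ih =>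
    obtain ⟨t⟩ := hi
    have hu' : IsSES u' (cokernel.π u' ≫ t.hom) := (IsSES.of_cokernel u').of_iso (Iso.refl _)
      (Iso.refl _) t (by simp) (by simp)
    have := h.epi
    have := hu'.epi
    have hk := IsSES.of_kernel (g ≫ cokernel.π u' ≫ t.hom)
    obtain ⟨f', g', hs, -, -⟩ := h.exists_pull hu' hk
    rw [add_right_comm]
    exact .of_isSES_simple hk (ih hs)

/-- Two maximal subobjects coincide, or their intersection is maximal in both, with the simple
quotients interchanged. -/
theorem IsSES.exchange {X Y Y' S S' : C} [Simple S] [Simple S'] {f : Y ⟶ X} {g : X ⟶ S}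
    {f' : Y' ⟶ X} {g' : X ⟶ S'} (h : IsSES f g) (h' : IsSES f' g') :
    (Nonempty (Y ≅ Y') ∧ Nonempty (S ≅ S')) ∨
      ∃ (Z : C) (k : Z ⟶ Y) (k' : Z ⟶ Y'), IsSES k (f ≫ g') ∧ IsSES k' (f' ≫ g) := by
  by_cases h0 : f ≫ g' = 0
  · obtain ⟨t, ht⟩ := h.exists_desc g' h0
    have : IsIso t := isIso_of_hom_simple fun h1 => h'.g_ne_zero (by rw [← ht, h1, comp_zero])
    have h2 : IsSES f g' := h.of_iso (Iso.refl _) (Iso.refl _) (asIso t) (by simp) (by simp [ht])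
    obtain ⟨s, -⟩ := h2.exists_iso_left h'
    exact .inl ⟨⟨s⟩, ⟨asIso t⟩⟩
  · have h1 : f' ≫ g ≠ 0 := fun h1 => h0 <| by
      obtain ⟨t, ht⟩ := h'.exists_desc g h1
      have : IsIso t := isIso_of_hom_simple fun h1 => h.g_ne_zero (by rw [← ht, h1, comp_zero])
      rw [← cancel_mono t, Category.assoc, ht, h.zero, zero_comp]
    have := epi_of_nonzero_to_simple h0
    have := epi_of_nonzero_to_simple h1
    have := h.mono
    have := h'.mono
    have hk := IsSES.of_kernel (f ≫ g')
    obtain ⟨k', hk'⟩ := h'.exists_lift (kernel.ι (f ≫ g') ≫ f) (by simp)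
    have : Mono (k' ≫ f') := by rw [hk']; infer_instance
    have : Mono k' := mono_of_mono k' f'
    refine .inr ⟨_, _, k', hk, IsSES.of_isKernel ?_ fun m hm => ?_⟩
    · rw [← Category.assoc, hk', Category.assoc, h.zero, comp_zero]
    · obtain ⟨l, hl⟩ := h.exists_lift (m ≫ f') (by simpa using hm)
      obtain ⟨l', hl'⟩ := hk.exists_lift l (by
        rw [← Category.assoc, hl, Category.assoc, h'.zero, comp_zero])
      exact ⟨l', by rw [← cancel_mono f', Category.assoc, hk', ← Category.assoc, hl', hl]⟩

theorem HasDimVec.eq_zero {X : C} {d : SimpleClass C →₀ ℕ} (h : HasDimVec X d) (hX : IsZero X) :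
    d = 0 := by
  obtain ⟨-, rfl⟩ | ⟨Y, i, f, g, d', hs, -, -⟩ := h.exists_isSES
  · rfl
  · exact absurd (hX.eq_of_src g 0) hs.g_ne_zero

/-- The Jordan-Hölder theorem: dimension vectors are unique. -/
theorem HasDimVec.unique (hC : ∀ X : C, ∃ d : SimpleClass C →₀ ℕ, HasDimVec X d) {X : C}
    {d e : SimpleClass C →₀ ℕ} (hd : HasDimVec X d) (he : HasDimVec X e) : d = e := by
  obtain ⟨n, hn⟩ : ∃ n, d.degree = n := ⟨_, rfl⟩
  induction n generalizing X d e with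
  | zero =>
    obtain rfl := (Finsupp.degree_eq_zero_iff d).1 hn
    exact (he.eq_zero hd.isZero).symm
  | succ n ih =>
    obtain ⟨hX, rfl⟩ | ⟨Y, i, f, g, d', hs, hY, rfl⟩ := hd.exists_isSES
    · simp at hn
    obtain ⟨hX, rfl⟩ | ⟨Y', j, f', g', e', hs', hY', rfl⟩ := he.exists_isSES
    · exact absurd (hX.eq_of_src g 0) hs.g_ne_zero
    have hn' : d'.degree = n := by simpa using hn
    obtain ⟨⟨s⟩, ⟨t⟩⟩ | ⟨Z, k, k', hk, hk'⟩ := hs.exchange hs'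
    · rw [SimpleClass.eq_of_iso t, ih hY (hY'.of_iso s.symm) hn']
    · obtain ⟨c, hc⟩ := hC Z
      have h₁ := ih hY (.of_isSES_simple hk hc) hn'
      have h₂ := ih (.of_isSES_simple hk' hc) hY' (by
        rw [← hn', h₁]; simp)
      rw [h₁, ← h₂, add_right_comm]

/-- There are only finitely many isomorphism classes of a given dimension vector. -/
theorem finite_setOf_hasDimVec [HasExt.{w} C] [∀ X Y : C, Finite (Ext.{w} X Y 1)]
    (d : SimpleClass C →₀ ℕ) : {α : IsoClass C | HasDimVec α.rep d}.Finite := by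
  obtain ⟨n, hn⟩ : ∃ n, d.degree = n := ⟨_, rfl⟩
  induction n generalizing d with
  | zero =>
    obtain rfl := (Finsupp.degree_eq_zero_iff d).1 hn
    refine Set.Subsingleton.finite fun α hα β hβ => ?_
    rw [← IsoClass.of_rep α, ← IsoClass.of_rep β]
    exact IsoClass.of_eq_of (IsZero.iso (HasDimVec.isZero hα) (HasDimVec.isZero hβ))
  | succ n ih =>
    refine (Set.finite_iUnion fun i : d.support => Set.finite_iUnion
      fun hi : (d - Finsupp.single i.1 1).degree = n => (ih _ hi).biUnion fun β _ =>
        Set.finite_range fun e : Ext.{w} i.1.1.rep β.rep 1 => midClass e).subset ?_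
    intro α hα
    obtain ⟨-, rfl⟩ | ⟨Y, i, f, g, d', hs, hY, rfl⟩ := HasDimVec.exists_isSES hα
    · simp at hn
    obtain ⟨t⟩ := IsoClass.nonempty_rep_iso Y
    have hs' : IsSES (t.hom ≫ f) g :=
      hs.of_iso t.symm (Iso.refl _) (Iso.refl _) (by simp) (by simp)
    have hd : d' + Finsupp.single i 1 - Finsupp.single i 1 = d' := add_tsub_cancel_right _ _
    have he : midClass (IsSES.cls.{w} hs') = α := by rw [midClass_cls, IsoClass.of_rep]
    simp only [Set.mem_iUnion]
    refine ⟨⟨i, by simp⟩, ?_, IsoClass.of Y, ?_, hs'.cls, he⟩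
    · rw [hd]; simpa using hn
    · rw [hd]; exact hY.of_iso t.symm

end DimVec

/-! ### The Euler form -/

section LinearAlgebra

variable {k V₁ V₂ V₃ V₄ V₅ V₆ : Type*} [Field k]
  [AddCommGroup V₁] [AddCommGroup V₂] [AddCommGroup V₃] [AddCommGroup V₄] [AddCommGroup V₅]
  [AddCommGroup V₆] [Module k V₁] [Module k V₂] [Module k V₃] [Module k V₄] [Module k V₅]
  [Module k V₆] [Module.Finite k V₁] [Module.Finite k V₂] [Module.Finite k V₃]
  [Module.Finite k V₄] [Module.Finite k V₅]

/-- The alternating sum of the dimensions in a six term exact sequence vanishes. -/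
theorem finrank_alternating_sum_of_exact (f₁ : V₁ →ₗ[k] V₂) (f₂ : V₂ →ₗ[k] V₃) (f₃ : V₃ →ₗ[k] V₄)
    (f₄ : V₄ →ₗ[k] V₅) (f₅ : V₅ →ₗ[k] V₆) (h₁ : Function.Injective f₁)
    (h₂ : Function.Exact f₁ f₂) (h₃ : Function.Exact f₂ f₃) (h₄ : Function.Exact f₃ f₄)
    (h₅ : Function.Exact f₄ f₅) (h₆ : Function.Surjective f₅) :
    (Module.finrank k V₂ : ℤ) - Module.finrank k V₅ =
      (Module.finrank k V₁ - Module.finrank k V₄) +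
        (Module.finrank k V₃ - Module.finrank k V₆) := by
  have e₁ := f₁.finrank_range_add_finrank_ker
  have e₂ := f₂.finrank_range_add_finrank_ker
  have e₃ := f₃.finrank_range_add_finrank_ker
  have e₄ := f₄.finrank_range_add_finrank_ker
  have e₅ := f₅.finrank_range_add_finrank_ker
  rw [LinearMap.ker_eq_bot.2 h₁, finrank_bot] at e₁
  rw [h₂.linearMap_ker_eq] at e₂
  rw [h₃.linearMap_ker_eq] at e₃
  rw [h₄.linearMap_ker_eq] at e₄
  rw [h₅.linearMap_ker_eq, LinearMap.range_eq_top.2 h₆, finrank_top] at e₅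
  omega

end LinearAlgebra

section Euler

variable (k : Type*) [Field k] {C : Type u} [Category.{v} C] [Abelian C] [Linear k C]
  [HasExt.{w} C] [IsHereditaryFinitaryLength.{w} k C]

instance finite_ext_zero (X Y : C)  : Module.Finite k (Ext.{w} X Y 0) :=
  have := IsHereditaryFinitaryLength.finite_hom.{w} (k := k) X Y
  Module.Finite.equiv (Ext.linearEquiv₀ (R := k) (X := X) (Y := Y)).symm

theorem eulerChar_right_add (N : C) {B M A : C} {f : B ⟶ M} {g : M ⟶ A} (h : IsSES f g) :
    eulerChar.{w} k N M = eulerChar.{w} k N B + eulerChar.{w} k N A := by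
  have := fun X Y : C => IsHereditaryFinitaryLength.finite_ext.{w} (k := k) X Y
  have := fun X Y : C => IsHereditaryFinitaryLength.ext_eq_zero.{w} (k := k) X Y 2 le_rfl
  have := h.mono
  have c₁ : (Ext.mk₀ g).comp h.2.extClass (zero_add 1) = 0 := h.2.comp_extClass
  have c₂ : h.2.extClass.comp (Ext.mk₀ f) (add_zero 1) = 0 := h.2.extClass_comp
  have := finrank_alternating_sum_of_exact
    (Ext.postcompOfLinear (Ext.mk₀ f) k N (add_zero 0))
    (Ext.postcompOfLinear (Ext.mk₀ g) k N (add_zero 0))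
    (Ext.postcompOfLinear h.2.extClass k N (zero_add 1))
    (Ext.postcompOfLinear (Ext.mk₀ f) k N (add_zero 1))
    (Ext.postcompOfLinear (Ext.mk₀ g) k N (add_zero 1))
    (Ext.postcomp_mk₀_injective_of_mono N f)
    (fun x => ⟨fun hx => Ext.covariant_sequence_exact₂ N h.2 x hx, ?_⟩)
    (fun x => ⟨fun hx => Ext.covariant_sequence_exact₃ N h.2 x rfl hx, ?_⟩)
    (fun x => ⟨fun hx => Ext.covariant_sequence_exact₁ N h.2 x hx rfl, ?_⟩)
    (fun x => ⟨fun hx => Ext.covariant_sequence_exact₂ N h.2 x hx, ?_⟩)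
    (fun x => Ext.covariant_sequence_exact₃ N h.2 x rfl (Subsingleton.elim _ _))
  · simp only [(Ext.linearEquiv₀ (R := k) (X := N)).finrank_eq] at this
    exact this
  all_goals
    rintro ⟨y, rfl⟩
    simp [h.zero, c₁, c₂]

theorem eulerChar_left_add (N : C) {B M A : C} {f : B ⟶ M} {g : M ⟶ A} (h : IsSES f g) :
    eulerChar.{w} k M N = eulerChar.{w} k B N + eulerChar.{w} k A N := by
  have := fun X Y : C => IsHereditaryFinitaryLength.finite_ext.{w} (k := k) X Y
  have := fun X Y : C => IsHereditaryFinitaryLength.ext_eq_zero.{w} (k := k) X Y 2 le_rfl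
  have := h.epi
  have c₁ {n m : ℕ} (y : Ext.{w} B N n) (hm : 1 + n = m) :
      (Ext.mk₀ g).comp (h.2.extClass.comp y hm) (zero_add m) = 0 := h.2.comp_extClass_assoc y hm
  have c₂ {n m : ℕ} (y : Ext.{w} M N n) (hm : 1 + n = m) :
      h.2.extClass.comp ((Ext.mk₀ f).comp y (zero_add n)) hm = 0 := h.2.extClass_comp_assoc y
  have := finrank_alternating_sum_of_exact
    (Ext.precompOfLinear (Ext.mk₀ g) k N (zero_add 0))
    (Ext.precompOfLinear (Ext.mk₀ f) k N (zero_add 0))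
    (Ext.precompOfLinear h.2.extClass k N (add_zero 1))
    (Ext.precompOfLinear (Ext.mk₀ g) k N (zero_add 1))
    (Ext.precompOfLinear (Ext.mk₀ f) k N (zero_add 1))
    (Ext.precomp_mk₀_injective_of_epi N g)
    (fun x => ⟨fun hx => Ext.contravariant_sequence_exact₂ h.2 N x hx, ?_⟩)
    (fun x => ⟨fun hx => Ext.contravariant_sequence_exact₁ h.2 N x rfl hx, ?_⟩)
    (fun x => ⟨fun hx => Ext.contravariant_sequence_exact₃ h.2 N x hx rfl, ?_⟩)
    (fun x => ⟨fun hx => Ext.contravariant_sequence_exact₂ h.2 N x hx, ?_⟩)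
    (fun x => Ext.contravariant_sequence_exact₁ h.2 N x rfl (Subsingleton.elim _ _))
  · simp only [(Ext.linearEquiv₀ (R := k) (Y := N)).finrank_eq] at this
    rw [add_comm]
    exact this
  all_goals
    rintro ⟨y, rfl⟩
    simp [h.zero, c₁, c₂]

omit [HasExt.{w} C] in
theorem IsSES.of_isZero {X Y Z : C} (hX : IsZero X) (hY : IsZero Y) (hZ : IsZero Z) :
    IsSES (0 : X ⟶ Y) (0 : Y ⟶ Z) :=
  have : Mono (0 : X ⟶ Y) := ⟨fun _ _ _ => hX.eq_of_tgt _ _⟩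
  have : Epi (0 : Y ⟶ Z) := ⟨fun _ _ _ => hZ.eq_of_src _ _⟩
  IsSES.of_isKernel (by simp) fun _ _ => ⟨0, hY.eq_of_tgt _ _⟩

theorem toIntVec_add {I : Type*} (d e : I →₀ ℕ) : toIntVec (d + e) = toIntVec d + toIntVec e :=
  Finsupp.mapRange_add (fun a b => Nat.cast_add a b) d e

theorem toIntVec_single {I : Type*} (i : I) :
    toIntVec (Finsupp.single i 1) = Finsupp.single i 1 := by
  simp [toIntVec]

/-- The Euler form of two objects depends on their dimension vectors only. -/
theorem eulerForm_eq_eulerChar {M N : C} {d e : SimpleClass C →₀ ℕ} (hM : HasDimVec M d)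
    (hN : HasDimVec N e) : eulerForm.{w} k C (toIntVec d) (toIntVec e) = eulerChar.{w} k M N := by
  have h₁ (i : SimpleClass C) {N : C} {e : SimpleClass C →₀ ℕ} (hN : HasDimVec N e) :
      eulerForm.{w} k C (Finsupp.single i 1) (toIntVec e) = eulerChar.{w} k i.1.rep N := by
    induction hN with
    | zero hX =>
      have := eulerChar_right_add.{w} k i.1.rep (IsSES.of_isZero hX hX hX)
      simp [toIntVec, show eulerChar.{w} k _ _ = 0 by simpa using this]
    | extend f hf j hj d _ ih =>
      obtain ⟨t⟩ := hj
      have := eulerChar_right_add.{w} k i.1.rep ((IsSES.of_cokernel f).of_iso (Iso.refl _)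
        (Iso.refl _) t (f' := f) (g' := cokernel.π f ≫ t.hom) (by simp) (by simp))
      rw [this, toIntVec_add, map_add, ih, toIntVec_single]
      simp [eulerForm]
  induction hM with
  | zero hX =>
    have := eulerChar_left_add.{w} k N (IsSES.of_isZero hX hX hX)
    simp [toIntVec, show eulerChar.{w} k _ _ = 0 by simpa using this]
  | extend f hf i hi d _ ih =>
    obtain ⟨t⟩ := hi
    have := eulerChar_left_add.{w} k N ((IsSES.of_cokernel f).of_iso (Iso.refl _)
      (Iso.refl _) t (f' := f) (g' := cokernel.π f ≫ t.hom) (by simp) (by simp))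
    rw [this, toIntVec_add, map_add, LinearMap.add_apply, ih, toIntVec_single, h₁ i hN]

theorem symEulerForm_eq {M N : C} {d e : SimpleClass C →₀ ℕ} (hM : HasDimVec M d)
    (hN : HasDimVec N e) : symEulerForm.{w} k C (toIntVec d) (toIntVec e) =
      eulerChar.{w} k M N + eulerChar.{w} k N M := by
  rw [symEulerForm, LinearMap.add_apply, LinearMap.add_apply, LinearMap.flip_apply,
    eulerForm_eq_eulerChar k hM hN, eulerForm_eq_eulerChar k hN hM]

omit [IsHereditaryFinitaryLength.{w} k C] in
theorem symEulerForm_comm (x y : SimpleClass C →₀ ℤ) :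
    symEulerForm.{w} k C x y = symEulerForm.{w} k C y x := by
  simp [symEulerForm, add_comm]

omit [IsHereditaryFinitaryLength.{w} k C] in
theorem symEulerForm_single_single (i j : SimpleClass C) :
    symEulerForm.{w} k C (Finsupp.single i 1) (Finsupp.single j 1) =
      eulerChar.{w} k i.1.rep j.1.rep + eulerChar.{w} k j.1.rep i.1.rep := by
  simp [symEulerForm, eulerForm]

end Euler

/-! ### Divisibility by the dimension of `End S` -/

section Divisibility

variable (k : Type*) [Field k] {C : Type u} [Category.{v} C] [Abelian C] [Linear k C]
  [HasExt.{w} C] (S Y : C) [Simple S]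

/-- `Ext¹(Y, S)` is a vector space over the division ring `End S`. -/
theorem finrank_end_dvd_finrank_ext_right :
    Module.finrank k (S ⟶ S) ∣ Module.finrank k (Ext.{w} Y S 1) := by
  let : Module (End S) (Ext.{w} Y S 1) :=
    { smul := fun f e => e.comp (Ext.mk₀ f) (add_zero 1)
      one_smul := fun e => Ext.comp_mk₀_id e
      mul_smul := fun f g e => by
        change e.comp (Ext.mk₀ (g ≫ f)) _ = (e.comp (Ext.mk₀ g) _).comp (Ext.mk₀ f) _
        simp
      smul_zero := fun f => by
        change (0 : Ext.{w} Y S 1).comp (Ext.mk₀ f) _ = 0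
        rw [Ext.zero_comp]
      smul_add := fun f e e' => Ext.add_comp _ _ _ _
      add_smul := fun f g e => by
        change e.comp (Ext.mk₀ (f + g)) _ = e.comp (Ext.mk₀ f) _ + e.comp (Ext.mk₀ g) _
        rw [Ext.mk₀_add, Ext.comp_add]
      zero_smul := fun e => by
        change e.comp (Ext.mk₀ 0) _ = 0
        rw [Ext.mk₀_zero, Ext.comp_zero] }
  have : IsScalarTower k (End S) (Ext.{w} Y S 1) := ⟨fun r f e => by
    change e.comp (Ext.mk₀ (r • f)) _ = r • e.comp (Ext.mk₀ f) _
    rw [Ext.mk₀_smul, Ext.comp_smul]⟩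
  exact ⟨_, (Module.finrank_mul_finrank k (End S) (Ext.{w} Y S 1)).symm⟩

/-- `Ext¹(S, Y)` is a vector space over the opposite of the division ring `End S`. -/
theorem finrank_end_dvd_finrank_ext_left :
    Module.finrank k (S ⟶ S) ∣ Module.finrank k (Ext.{w} S Y 1) := by
  let : Module (End S)ᵐᵒᵖ (Ext.{w} S Y 1) :=
    { smul := fun f e => (Ext.mk₀ f.unop).comp e (zero_add 1)
      one_smul := fun e => Ext.mk₀_id_comp e
      mul_smul := fun f g e => by
        change (Ext.mk₀ (f.unop ≫ g.unop)).comp e _ =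
          (Ext.mk₀ f.unop).comp ((Ext.mk₀ g.unop).comp e _) _
        simp
      smul_zero := fun f => by
        change (Ext.mk₀ f.unop).comp (0 : Ext.{w} S Y 1) _ = 0
        rw [Ext.comp_zero]
      smul_add := fun f e e' => Ext.comp_add _ _ _ _
      add_smul := fun f g e => by
        change (Ext.mk₀ (f.unop + g.unop)).comp e _ =
          (Ext.mk₀ f.unop).comp e _ + (Ext.mk₀ g.unop).comp e _
        rw [Ext.mk₀_add, Ext.add_comp]
      zero_smul := fun e => by
        change (Ext.mk₀ 0).comp e _ = 0
        rw [Ext.mk₀_zero, Ext.zero_comp] }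
  have : IsScalarTower k (End S)ᵐᵒᵖ (Ext.{w} S Y 1) := ⟨fun r f e => by
    change (Ext.mk₀ (r • f.unop)).comp e _ = r • (Ext.mk₀ f.unop).comp e _
    rw [Ext.mk₀_smul, Ext.smul_comp]⟩
  have h := Module.finrank_mul_finrank k (End S)ᵐᵒᵖ (Ext.{w} S Y 1)
  rw [← (MulOpposite.opLinearEquiv k (M := End S)).finrank_eq] at h
  exact ⟨_, h.symm⟩

end Divisibility

/-! ### Hall numbers and primitive elements -/

section Hall

variable {C : Type u} [Category.{v} C] [Abelian C] [∀ X Y : C, Finite (X ⟶ Y)]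

/-- Every subobject that `hallNumber` counts is the image of the inclusion in
`|Aut B| * |Aut A|` short exact sequences. -/
theorem card_extension_eq (A B : C) (γ : IsoClass C) :
    Nat.card (Extension A B γ.rep) = hallNumber (IsoClass.of A) (IsoClass.of B) γ *
      (autCard (IsoClass.of B) * autCard (IsoClass.of A)) := by
  let Φ : Extension A B γ.rep → {X : Subobject γ.rep // Nonempty ((X : C) ≅ (IsoClass.of B).rep) ∧
      Nonempty (cokernel X.arrow ≅ (IsoClass.of A).rep)} := fun x =>
    have := x.isSES.mono
    ⟨Subobject.mk x.f, by
      obtain ⟨b⟩ := IsoClass.nonempty_rep_iso B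
      exact ⟨Subobject.underlyingIso x.f ≪≫ b.symm⟩, by
      obtain ⟨a⟩ := IsoClass.nonempty_rep_iso A
      have h : IsSES (Subobject.mk x.f).arrow x.g :=
        x.isSES.of_iso (Subobject.underlyingIso x.f).symm
        (Iso.refl _) (Iso.refl _) (by simp) (by simp)
      obtain ⟨t, -⟩ := (IsSES.of_cokernel _).exists_iso_right h
      exact ⟨t ≪≫ a.symm⟩⟩
  have hΦ (X : {X : Subobject γ.rep // Nonempty ((X : C) ≅ (IsoClass.of B).rep) ∧
      Nonempty (cokernel X.arrow ≅ (IsoClass.of A).rep)}) : Nat.card {x // Φ x = X} =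
        autCard (IsoClass.of B) * autCard (IsoClass.of A) := by
    obtain ⟨X, hB, hA⟩ := X
    rw [← card_iso_eq_autCard (M := B) (N := X) rfl (IsoClass.of_eq_iff.2 hB),
      ← card_iso_eq_autCard (M := cokernel X.arrow) (N := A) (IsoClass.of_eq_iff.2 hA) rfl,
      ← Nat.card_prod]
    have hs (p : (B ≅ (X : C)) × (cokernel X.arrow ≅ A)) :
        IsSES (p.1.hom ≫ X.arrow) (cokernel.π X.arrow ≫ p.2.hom) :=
      (IsSES.of_cokernel X.arrow).of_iso p.1.symm (Iso.refl _) p.2 (by simp) (by simp)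
    refine (Nat.card_eq_of_bijective (fun p => (⟨.mk (hs p), Subtype.ext ?_⟩ :
      {x // Φ x = ⟨X, hB, hA⟩})) ⟨fun p q h => ?_, ?_⟩).symm
    · have := (hs p).mono
      change Subobject.mk (p.1.hom ≫ X.arrow) = X
      conv_rhs => rw [← Subobject.mk_arrow X]
      exact Subobject.mk_eq_mk_of_comm _ _ p.1 rfl
    · have h₁ := congrArg (fun x => x.1.f) h
      have h₂ := congrArg (fun x => x.1.g) h
      exact Prod.ext (Iso.ext ((cancel_mono X.arrow).1 h₁))
        (Iso.ext ((cancel_epi (cokernel.π X.arrow)).1 h₂))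
    · rintro ⟨x, hx⟩
      have := x.isSES.mono
      obtain rfl : Subobject.mk x.f = X := congrArg Subtype.val hx
      have h : IsSES (Subobject.mk x.f).arrow x.g := x.isSES.of_iso
        (Subobject.underlyingIso x.f).symm (Iso.refl _) (Iso.refl _) (by simp) (by simp)
      obtain ⟨t, ht⟩ := (IsSES.of_cokernel _).exists_iso_right h
      exact ⟨((Subobject.underlyingIso x.f).symm, t), Subtype.ext (Extension.ext
        (by simp) ht)⟩
  have hpos : autCard (IsoClass.of B) * autCard (IsoClass.of A) ≠ 0 :=
    mul_ne_zero (autCard_pos _).ne' (autCard_pos _).ne'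
  have hsurj : Function.Surjective Φ := fun X => by
    have : Nonempty {x // Φ x = X} := (Nat.card_ne_zero.1 ((hΦ X).trans_ne hpos)).1
    exact ⟨this.some.1, this.some.2⟩
  have := Finite.of_surjective Φ hsurj
  exact Nat.card_eq_mul_of_card_fiber Φ _ hΦ

end Hall

section Primitive

variable (k : Type*) [Field k] [Finite k] {C : Type u} [Category.{v} C] [Abelian C] [Linear k C]
  [HasExt.{w} C] [IsHereditaryFinitaryLength.{w} k C]

omit [Abelian C] [HasExt.{w} C] in
theorem hallForm_apply (x y : HallSpace C) :
    hallForm C x y = x.sum fun α c => c * (1 / (autCard α : ℂ) * y α) := by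
  simp [hallForm, Finsupp.linearCombination_apply, Finsupp.sum, LinearMap.sum_apply]

theorem hallMul_single (α β γ : IsoClass C) :
    hallMul.{w} k C (Finsupp.single α 1) (Finsupp.single β 1) γ =
      hallV k ^ eulerChar.{w} k α.rep β.rep * (hallNumber α β γ : ℂ) := by
  simp only [hallMul, hallBasisMul, Finsupp.linearCombination_single, one_smul]
  rfl

theorem hallV_ne_zero : hallV k ≠ 0 := by
  have : 0 < Nat.card k := Nat.card_pos
  simp [hallV, this.ne']

include k in
theorem finite_hom_of_hereditary (X Y : C) : Finite (X ⟶ Y) :=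
  have := IsHereditaryFinitaryLength.finite_hom.{w} (k := k) X Y
  Module.finite_of_finite k

include k in
theorem finite_ext_of_hereditary (X Y : C) : Finite (Ext.{w} X Y 1) :=
  have := IsHereditaryFinitaryLength.finite_ext.{w} (k := k) X Y
  Module.finite_of_finite k

variable {k}

theorem ne_zero_and_ne_single_of_mem_hallL {θ : SimpleClass C →₀ ℕ} {x : HallSpace C}
    (hx : x ∈ hallL.{w} k θ) (hx0 : x ≠ 0) : ¬ (θ = 0 ∨ ∃ i, θ = Finsupp.single i 1) := by
  intro hθ
  have := finite_hom_of_hereditary.{w} (C := C) k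
  apply hx0
  ext α
  by_contra h
  have hα : HasDimVec α.rep θ := hx.1 (Finsupp.mem_support_iff.2 h)
  have h₁ := hx.2 (Finsupp.single α 1) (by
    rw [hallXi, if_pos hθ]
    exact Finsupp.single_mem_supported ℂ 1 hα)
  rw [hallForm_apply, Finsupp.sum, Finset.sum_eq_single α] at h₁
  · have := (autCard_pos α).ne'
    simp_all
  · intro β _ hβ
    simp [Finsupp.single_eq_of_ne hβ]
  · exact fun h' => absurd (Finsupp.mem_support_iff.2 h) h'

/-- An element that is orthogonal to all products is primitive: its values at the middle terms of
the extensions of `A` by `B` add up to zero. -/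
theorem sum_midClass_eq_zero [∀ X Y : C, Finite (X ⟶ Y)] [∀ X Y : C, Finite (Ext.{w} X Y 1)]
    {θ : SimpleClass C →₀ ℕ} {x : HallSpace C}
    (hx : x ∈ hallL.{w} k θ) (hx0 : x ≠ 0) (L : ℂ →ₗ[ℝ] ℝ) {A B : C} {μ ν : SimpleClass C →₀ ℕ}
    (hA : HasDimVec A μ) (hB : HasDimVec B ν) (hμν : μ + ν = θ → μ ≠ θ ∧ ν ≠ θ) :
    ∑ e : Ext.{w} A B 1, x.mapRange L L.map_zero (midClass e) = 0 := by
  by_cases hθ : μ + ν = θ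
  · have h₁ := hx.2 (hallMul.{w} k C (Finsupp.single (IsoClass.of A) 1)
      (Finsupp.single (IsoClass.of B) 1)) (by
      rw [hallXi, if_neg (ne_zero_and_ne_single_of_mem_hallL hx hx0)]
      obtain ⟨a⟩ := IsoClass.nonempty_rep_iso A
      obtain ⟨b⟩ := IsoClass.nonempty_rep_iso B
      exact Submodule.subset_span ⟨μ, ν, _, _, hθ, (hμν hθ).1, (hμν hθ).2,
        Finsupp.single_mem_supported ℂ 1 (hA.of_iso a.symm),
        Finsupp.single_mem_supported ℂ 1 (hB.of_iso b.symm), rfl⟩)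
    have hv := zpow_ne_zero (eulerChar.{w} k (IsoClass.of A).rep (IsoClass.of B).rep)
      (hallV_ne_zero k)
    rw [hallForm_apply, Finsupp.sum] at h₁
    simp_rw [hallMul_single] at h₁
    have h₂ : ∑ γ ∈ x.support, ((autCard γ : ℝ)⁻¹ *
        hallNumber (IsoClass.of A) (IsoClass.of B) γ) • x γ = 0 := by
      refine (mul_eq_zero.1 (Eq.trans ?_ h₁)).resolve_left hv
      rw [Finset.mul_sum]
      refine Finset.sum_congr rfl fun γ _ => ?_
      rw [Complex.real_smul]
      push_cast
      ring
    have h₃ := congrArg L h₂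
    rw [map_sum, map_zero] at h₃
    have h₄ := sum_extension_eq.{w} (A := A) (B := B) x.support
      (fun e => x.mapRange L L.map_zero (midClass e)) (fun e he => Finsupp.mem_support_iff.2
        fun h => he (by rw [Finsupp.mapRange_apply, h, map_zero]))
    have hAB : (Nat.card (A ⟶ B) : ℝ) ≠ 0 := Nat.cast_ne_zero.2 Nat.card_pos.ne'
    refine (mul_eq_zero.1 (h₄.symm.trans ?_)).resolve_left (inv_ne_zero hAB)
    have h₅ : ∀ γ ∈ x.support, (autCard γ : ℝ)⁻¹ * ∑ y : Extension A B γ.rep,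
        x.mapRange L L.map_zero (midClass (y.cls)) =
        ((autCard (IsoClass.of B) * autCard (IsoClass.of A) : ℕ) : ℝ) *
          L (((autCard γ : ℝ)⁻¹ * hallNumber (IsoClass.of A) (IsoClass.of B) γ) • x γ) := by
      intro γ _
      have h₆ (y : Extension A B γ.rep) : midClass y.cls = γ :=
        (midClass_cls.{w} y.isSES).trans (IsoClass.of_rep γ)
      simp_rw [h₆]
      rw [Finset.sum_const, Finset.card_univ, nsmul_eq_mul, ← Nat.card_eq_fintype_card,
        card_extension_eq, map_smul, Finsupp.mapRange_apply, smul_eq_mul]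
      push_cast
      ring
    rw [Finset.sum_congr rfl h₅, ← Finset.mul_sum, h₃, mul_zero]
  · refine Finset.sum_eq_zero fun e _ => ?_
    rw [Finsupp.mapRange_apply]
    obtain ⟨y, -⟩ := exists_extension e
    have h : x (midClass e) = 0 := by
      by_contra h
      have h₁ : HasDimVec (midClass e).rep θ := hx.1 (Finsupp.mem_support_iff.2 h)
      exact hθ (HasDimVec.unique (IsHereditaryFinitaryLength.exists_dimVec.{w} (k := k))
        (hA.add hB y.isSES) h₁)
    rw [h, map_zero]

/-- The degree of a nonzero element of `L_θ` pairs nonpositively with all simple classes. -/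
theorem symEulerForm_single_nonpos {θ : SimpleClass C →₀ ℕ} {x : HallSpace C}
    (hx : x ∈ hallL.{w} k θ) (hx0 : x ≠ 0) (i : SimpleClass C) :
    symEulerForm.{w} k C (Finsupp.single i 1) (toIntVec θ) ≤ 0 := by
  have := finite_hom_of_hereditary.{w} (C := C) k
  have := finite_ext_of_hereditary.{w} (C := C) k
  have := IsHereditaryFinitaryLength.finite_hom.{w} (k := k) (C := C)
  have := IsHereditaryFinitaryLength.finite_ext.{w} (k := k) (C := C)
  have hdim := IsHereditaryFinitaryLength.exists_dimVec.{w} (k := k) (C := C)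
  have hθ := ne_zero_and_ne_single_of_mem_hallL hx hx0
  push Not at hθ
  -- orthogonality to the products is defined over `ℝ`, so that `x` may be replaced by its real or
  -- its imaginary part
  obtain ⟨L, hL⟩ : ∃ L : ℂ →ₗ[ℝ] ℝ, x.mapRange L L.map_zero ≠ 0 := by
    by_contra! h
    refine hx0 (Finsupp.ext fun α => Complex.ext ?_ ?_)
    · exact DFunLike.congr_fun (h Complex.reLm) α
    · exact DFunLike.congr_fun (h Complex.imLm) α
  set y := x.mapRange L L.map_zero
  have hy : ∀ X ∈ y.support, HasDimVec X.rep θ := fun X hX =>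
    hx.1 (Finsupp.support_mapRange hX)
  have hS := HasDimVec.simple i
  have hq : 1 < (Nat.card k : ℝ) := by exact_mod_cast Finite.one_lt_card
  have hq0 : (Nat.card k : ℝ) ≠ 0 := (zero_lt_one.trans hq).ne'
  have hcard (X Y : C) : (Nat.card (Ext.{w} X Y 1) : ℝ) =
      (Nat.card k : ℝ) ^ (-eulerChar.{w} k X Y) * Nat.card (X ⟶ Y) := by
    rw [Module.natCard_eq_pow_finrank (K := k), Module.natCard_eq_pow_finrank (K := k) (V := X ⟶ Y)]
    push_cast
    rw [← zpow_natCast, ← zpow_natCast, ← zpow_add₀ hq0, eulerChar]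
    congr 1
    ring
  have key := one_le_mul_of_primitive.{w} (S := i.1.rep) y hL
    (a := (Nat.card k : ℝ) ^ (-eulerForm.{w} k C (toIntVec (Finsupp.single i 1)) (toIntVec θ)))
    (b := (Nat.card k : ℝ) ^ (-eulerForm.{w} k C (toIntVec θ) (toIntVec (Finsupp.single i 1))))
    (fun X hX => by rw [hcard, eulerForm_eq_eulerChar k hS (hy X hX)])
    (fun X hX => by rw [hcard, eulerForm_eq_eulerChar k (hy X hX) hS])
    (fun B => by
      obtain ⟨ν, hν⟩ := hdim B
      refine sum_midClass_eq_zero hx hx0 L hS hν fun h => ⟨(hθ.2 i).symm, fun h' => ?_⟩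
      simp [h'] at h)
    (fun A => by
      obtain ⟨μ, hμ⟩ := hdim A
      refine sum_midClass_eq_zero hx hx0 L hμ hS fun h => ⟨fun h' => ?_, (hθ.2 i).symm⟩
      simp [h'] at h)
    (fun p _ e => Ext.covariant_sequence_exact₃ _ (IsSES.of_kernel p).2 e rfl
      (have := IsHereditaryFinitaryLength.ext_eq_zero.{w} (k := k) i.1.rep (kernel p) 2 le_rfl
      Subsingleton.elim _ _))
  rw [← zpow_add₀ hq0, one_le_zpow_iff_right₀ hq] at key
  rw [symEulerForm, LinearMap.add_apply, LinearMap.add_apply, LinearMap.flip_apply,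
    ← toIntVec_single]
  linarith

end Primitive

/-! ### The enlarged form -/

section Main

variable (k : Type*) [Field k] [Finite k] {C : Type u} [Category.{v} C] [Abelian C] [Linear k C]
  [HasExt.{w} C] [IsHereditaryFinitaryLength.{w} k C]

theorem finiteDimensional_hallL (θ : SimpleClass C →₀ ℕ) :
    FiniteDimensional ℂ (hallL.{w} k θ) := by
  have := finite_ext_of_hereditary.{w} (C := C) k
  have : Finite {α : IsoClass C | HasDimVec α.rep θ} := (finite_setOf_hasDimVec.{w} θ).to_subtype
  have : FiniteDimensional ℂ (hallDegree (C := C) θ) :=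
    Module.Finite.equiv (Finsupp.supportedEquivFinsupp {α : IsoClass C | HasDimVec α.rep θ}).symm
  exact Submodule.finiteDimensional_of_le (S₂ := hallDegree θ) fun x hx => hx.1

variable {k}

omit [Finite k] [IsHereditaryFinitaryLength.{w} k C] in
/-- A property that is closed under addition and holds for the pairings of `z` with all simple
classes holds for the pairings of `z` with all dimension vectors. -/
theorem symEulerForm_toIntVec_induction {p : ℤ → Prop} (h₀ : p 0)
    (hadd : ∀ a b, p a → p b → p (a + b)) {z : SimpleClass C →₀ ℤ} (d : SimpleClass C →₀ ℕ)
    (h : ∀ i, p (symEulerForm.{w} k C (Finsupp.single i 1) z)) :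
    p (symEulerForm.{w} k C (toIntVec d) z) := by
  induction d using Finsupp.induction_linear with
  | zero => simpa [toIntVec] using h₀
  | add d e hd he =>
    rw [toIntVec_add, map_add, LinearMap.add_apply]
    exact hadd _ _ hd he
  | single i n =>
    induction n with
    | zero => simpa [toIntVec] using h₀
    | succ n ih =>
      rw [Finsupp.single_add, toIntVec_add, map_add, LinearMap.add_apply, toIntVec_single]
      exact hadd _ _ ih (h i)

omit [Finite k] [HasExt.{w} C] [IsHereditaryFinitaryLength.{w} k C] in
theorem finrank_hom_eq_zero_of_ne {i j : SimpleClass C} (h : i ≠ j) :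
    Module.finrank k (i.1.rep ⟶ j.1.rep) = 0 := by
  have : Subsingleton (i.1.rep ⟶ j.1.rep) := by
    refine subsingleton_of_forall_eq 0 fun f => ?_
    by_contra hf
    have := isIso_of_hom_simple hf
    exact h (SimpleClass.eq_of_iso (asIso f))
  exact Module.finrank_zero_of_subsingleton

omit [Finite k] [IsHereditaryFinitaryLength.{w} k C] in
theorem symEulerForm_single_single_nonpos {i j : SimpleClass C} (h : i ≠ j) :
    symEulerForm.{w} k C (Finsupp.single i 1) (Finsupp.single j 1) ≤ 0 := by
  rw [symEulerForm_single_single, eulerChar, eulerChar, finrank_hom_eq_zero_of_ne h,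
    finrank_hom_eq_zero_of_ne h.symm]
  simp only [Nat.cast_zero]
  omega

omit [Finite k] [IsHereditaryFinitaryLength.{w} k C] in
theorem finrank_end_dvd_symEulerForm (i j : SimpleClass C) :
    (Module.finrank k (i.1.rep ⟶ i.1.rep) : ℤ) ∣
      symEulerForm.{w} k C (Finsupp.single i 1) (Finsupp.single j 1) := by
  have h₁ : (Module.finrank k (i.1.rep ⟶ i.1.rep) : ℤ) ∣
      Module.finrank k (Ext.{w} i.1.rep j.1.rep 1) :=
    Int.natCast_dvd_natCast.2 (finrank_end_dvd_finrank_ext_left k _ _)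
  have h₂ : (Module.finrank k (i.1.rep ⟶ i.1.rep) : ℤ) ∣
      Module.finrank k (Ext.{w} j.1.rep i.1.rep 1) :=
    Int.natCast_dvd_natCast.2 (finrank_end_dvd_finrank_ext_right k _ _)
  rw [symEulerForm_single_single, eulerChar, eulerChar]
  rcases eq_or_ne i j with rfl | h
  · exact dvd_add (dvd_sub dvd_rfl h₁) (dvd_sub dvd_rfl h₁)
  · rw [finrank_hom_eq_zero_of_ne h, finrank_hom_eq_zero_of_ne h.symm]
    exact dvd_add (dvd_sub (by simp) h₁) (dvd_sub (by simp) h₂)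

omit [Finite k] [IsHereditaryFinitaryLength.{w} k C] in
/-- A positive diagonal value at a simple class `i` is `2 dim End(S_i)`, because then
`Ext¹(S_i, S_i)`, whose dimension is a multiple of that of `End(S_i)`, vanishes. -/
theorem symEulerForm_single_self_of_pos {i : SimpleClass C}
    (h : 0 < symEulerForm.{w} k C (Finsupp.single i 1) (Finsupp.single i 1)) :
    symEulerForm.{w} k C (Finsupp.single i 1) (Finsupp.single i 1) =
      2 * Module.finrank k (i.1.rep ⟶ i.1.rep) := by
  have h₁ := finrank_end_dvd_finrank_ext_left.{w} k i.1.rep i.1.rep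
  rw [symEulerForm_single_single, eulerChar] at h ⊢
  have h₂ : Module.finrank k (Ext.{w} i.1.rep i.1.rep 1) = 0 :=
    Nat.eq_zero_of_dvd_of_lt h₁ (by omega)
  rw [h₂]
  simp only [Nat.cast_zero]
  ring

variable (k C) in
/-- The image in `ℤI` of a basis element of `ℤI'`. -/
noncomputable def enlargedWeight : EnlargedIndex.{w} k C → SimpleClass C →₀ ℤ :=
  Sum.elim (fun i => Finsupp.single i 1) fun j => toIntVec j.1

theorem enlargedForm_single (i j : EnlargedIndex.{w} k C) :
    enlargedForm.{w} k C (Finsupp.single i 1) (Finsupp.single j 1) =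
      symEulerForm.{w} k C (enlargedWeight k C i) (enlargedWeight k C j) := by
  simp [enlargedForm, varpi, enlargedWeight]

theorem symEulerForm_single_newIndex_nonpos (i : SimpleClass C) (j : NewIndex.{w} k C) :
    symEulerForm.{w} k C (Finsupp.single i 1) (toIntVec j.1) ≤ 0 := by
  have : Nontrivial (hallL.{w} k j.1) :=
    Module.nontrivial_of_finrank_pos (R := ℂ) (Nat.zero_lt_of_lt j.2.2)
  obtain ⟨x, hx⟩ := exists_ne (0 : hallL.{w} k j.1)
  exact symEulerForm_single_nonpos x.2 (fun h => hx (Subtype.ext h)) i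

theorem symEulerForm_newIndex_nonpos (d : SimpleClass C →₀ ℕ) (j : NewIndex.{w} k C) :
    symEulerForm.{w} k C (toIntVec d) (toIntVec j.1) ≤ 0 :=
  symEulerForm_toIntVec_induction (p := (· ≤ 0)) le_rfl (fun _ _ => add_nonpos) d
    fun i => symEulerForm_single_newIndex_nonpos i j

theorem enlargedForm_single_nonpos {i j : EnlargedIndex.{w} k C} (h : i ≠ j) :
    enlargedForm.{w} k C (Finsupp.single i 1) (Finsupp.single j 1) ≤ 0 := by
  rw [enlargedForm_single]
  rcases i with i | i <;> rcases j with j | j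
  · exact symEulerForm_single_single_nonpos fun h' => h (congrArg _ h')
  · exact symEulerForm_single_newIndex_nonpos i j
  · rw [symEulerForm_comm]
    exact symEulerForm_single_newIndex_nonpos j i
  · exact symEulerForm_newIndex_nonpos i.1 j

theorem enlargedForm_newIndex_nonpos (j : NewIndex.{w} k C) :
    enlargedForm.{w} k C (Finsupp.single (Sum.inr j) 1) (Finsupp.single (Sum.inr j) 1) ≤ 0 := by
  rw [enlargedForm_single]
  exact symEulerForm_newIndex_nonpos j.1 j

theorem finrank_end_dvd_symEulerForm_enlargedWeight (i : SimpleClass C)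
    (j : EnlargedIndex.{w} k C) : (Module.finrank k (i.1.rep ⟶ i.1.rep) : ℤ) ∣
      symEulerForm.{w} k C (Finsupp.single i 1) (enlargedWeight k C j) := by
  rcases j with j | j
  · exact finrank_end_dvd_symEulerForm i j
  · rw [symEulerForm_comm]
    refine symEulerForm_toIntVec_induction (p := (_ ∣ ·)) (dvd_zero _) (fun _ _ => dvd_add) _
      fun l => ?_
    rw [symEulerForm_comm]
    exact finrank_end_dvd_symEulerForm i l

theorem exists_int_eq_two_mul_enlargedForm_div {i j : EnlargedIndex.{w} k C}
    (h : 0 < enlargedForm.{w} k C (Finsupp.single i 1) (Finsupp.single i 1)) :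
    ∃ m : ℤ, (2 * enlargedForm.{w} k C (Finsupp.single i 1) (Finsupp.single j 1) : ℚ) /
      (enlargedForm.{w} k C (Finsupp.single i 1) (Finsupp.single i 1) : ℚ) = (m : ℚ) := by
  rcases i with i | i
  · rw [enlargedForm_single] at h
    obtain ⟨m, hm⟩ := finrank_end_dvd_symEulerForm_enlargedWeight i j
    refine ⟨m, ?_⟩
    rw [enlargedForm_single, enlargedForm_single]
    change (2 * (symEulerForm.{w} k C (Finsupp.single i 1) (enlargedWeight k C j) : ℤ) : ℚ) /
      (symEulerForm.{w} k C (Finsupp.single i 1) (Finsupp.single i 1) : ℤ) = m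
    have h₁ := symEulerForm_single_self_of_pos.{w} (k := k) (i := i) h
    have h₂ : 0 < (2 * Module.finrank k (i.1.rep ⟶ i.1.rep) : ℤ) := h₁ ▸ h
    have h₃ : (Module.finrank k (i.1.rep ⟶ i.1.rep) : ℚ) ≠ 0 := by
      have : Module.finrank k (i.1.rep ⟶ i.1.rep) ≠ 0 := by omega
      exact_mod_cast this
    rw [h₁, hm]
    push_cast
    field_simp
  · exact absurd (enlargedForm_newIndex_nonpos i) (not_le.2 h)

end Main

theorem mainTheorem5 (k : Type*) [Field k] [Finite k] (C : Type u) [Category.{v} C] [Abelian C]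
    [Linear k C] [HasExt.{w} C] [IsHereditaryFinitaryLength.{w} k C] :
    -- the symmetric Euler form on `ℤI` is the one of the objects of the category
    (∀ (M N : C) (d e : SimpleClass C →₀ ℕ), HasDimVec M d → HasDimVec N e →
      symEulerForm.{w} k C (toIntVec d) (toIntVec e) =
        eulerChar.{w} k M N + eulerChar.{w} k N M) ∧
    -- the spaces that define the new indices are finite dimensional
    (∀ θ : SimpleClass C →₀ ℕ, FiniteDimensional ℂ (hallL.{w} k θ)) ∧
    (∀ i j : EnlargedIndex.{w} k C, i ≠ j →
      enlargedForm.{w} k C (Finsupp.single i 1) (Finsupp.single j 1) ≤ 0) ∧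
    (∀ j : NewIndex.{w} k C,
      enlargedForm.{w} k C (Finsupp.single (Sum.inr j) 1) (Finsupp.single (Sum.inr j) 1) ≤ 0) ∧
    (∀ i j : EnlargedIndex.{w} k C,
      0 < enlargedForm.{w} k C (Finsupp.single i 1) (Finsupp.single i 1) →
      ∃ m : ℤ, (2 * enlargedForm.{w} k C (Finsupp.single i 1) (Finsupp.single j 1) : ℚ) /
        (enlargedForm.{w} k C (Finsupp.single i 1) (Finsupp.single i 1) : ℚ) = (m : ℚ)) ∧
    IsGeneralizedKacMoodyForm (enlargedForm.{w} k C) :=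
  ⟨fun _ _ _ _ hM hN => symEulerForm_eq k hM hN, finiteDimensional_hallL k,
    fun _ _ h => enlargedForm_single_nonpos h, enlargedForm_newIndex_nonpos,
    fun _ _ h => exists_int_eq_two_mul_enlargedForm_div h,
    { symm := fun _ _ => symEulerForm_comm k _ _
      nonpos := fun _ _ h => enlargedForm_single_nonpos h
      integral := fun _ _ h => exists_int_eq_two_mul_enlargedForm_div h }⟩
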